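/- Let $d\ge 2$ and $n\ge 3$. Let $G(d,1,n)$ be the group generated by $s_1,\dots,s_n$ with relations $s_n^d=1$, $s_i^2=1$ $(1\le i\le n-1)$, $s_is_j=s_js_i$ $(j+1<i\le n)$, $s_{i+1}s_is_{i+1}=s_is_{i+1}s_i$ $(1\le i\le n-2)$ and $s_ns_{n-1}s_ns_{n-1}=s_{n-1}s_ns_{n-1}s_n$. Let $G(d,d,n)$ be the group generated by $\tilde s_1,\dots,\tilde s_n$ with relations $\tilde s_i^2=1$ $(1\le i\le n)$, $(\tilde s_n\tilde s_{n-1})^d=1$, $\tilde s_i\tilde s_j=\tilde s_j\tilde s_i$ $(j+1<i\le n-1)$, $\tilde s_n\tilde s_j=\tilde s_j\tilde s_n$ $(j\le n-3)$, $\tilde s_{i+1}\tilde s_i\tilde s_{i+1}=\tilde s_i\tilde s_{i+1}\tilde s_i$ $(1\le i\le n-2)$, $\tilde s_n\tilde s_{n-2}\tilde s_n=\tilde s_{n-2}\tilde s_n\tilde s_{n-2}$ and $(\tilde s_n\tilde s_{n-1}\tilde s_{n-2})^2=(\tilde s_{n-2}\tilde s_n\tilde s_{n-1})^2$. Let $\iota:G(d,d,n)\to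 G(d,1,n)$ be the homomorphism (an embedding) with $\iota(\tilde s_n)=s_n^{d-1}s_{n-1}s_n$ and $\iota(\tilde s_i)=s_i$ for $1\le i\le n-1$. For $w\in G(d,1,n)$, let $R(w)$ be the set of words of minimal length in the letters $s_1,\dots,s_n$ (no inverses) that represent $w$. The element $w$ is called fully commutative if $R(w)$ is a single class for the equivalence relation on words generated by the relations $s_is_j=s_js_i$, $j+1<i\le n$. An element $g\in G(d,d,n)$ is called fully commutative if $\iota(g)$ is fully commutative in $G(d,1,n)$. For $1\le i\le n$ and $1\le j\le n$ let $s_{ij}$ be the word $s_is_{i-1}\cdots s_j$ (empty if $i<j$), and let $s^{(k)}_{nj}=s_n^k\,s_{n-1,j}$ for $k\ge 1$. A prefix is a word $s_{1i_1}s_{2i_2}\cdots s_{n-1,i_{n-1}}$ with $1\le i_p\le p+1$. A suffix is a word $s^{(k_1)}_{nj_1}\cdots s^{(k_\ell)}_{nj_\ell}$ with $\ell\ge 0$, $1\le j_1<\cdots<j_\ell\le n$ and $1\le k_p\le d-1$. The collection labeled by a suffix $\boldsymbol w'$ is the set of all words $\boldsymbol w_0\boldsymbol w'$, with $\boldsymbol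 w_0$ a prefix, that represent fully commutative elements of $G(d,1,n)$. The $(n,k)$-packet of $G(d,1,n)$ is the set of the collections labeled by the following suffixes: for $k=n$, the empty suffix; for $k=n-1$, the suffixes $s_n^t$ and $s^{(t)}_{n,n-1}$; for $0\le k\le n-2$, the suffixes with $\ell\ge 2$ and $j_1=k+1$ and, if $k\ge 1$, also the suffixes $s^{(t)}_{nk}$ (always $1\le t\le d-1$). The packet $\mathcal P(n,k)$ of $G(d,d,n)$ is the set of those collections in the $(n,k)$-packet of $G(d,1,n)$ all of whose words represent elements of $\iota(G(d,d,n))$. Let $C_n=\frac1{n+1}\binom{2n}{n}$, let $C(n,k)=\frac{(n+k)!\,(n-k+1)}{k!\,(n+1)!}$ for $0\le k\le n$, and let $\mathfrak F_{n,k}(x)=\sum_{s=0}^{k}C(n,s)\,x^{k-s}$. Then the number of fully commutative elements of $G(d,d,n)$ is finite and equal to $$\sum_{k=0}^n C(n,k)\,|\mathcal P(n,k)| = (d-1)\,\mathfrak F_{n,n-2}(d)+C_n .$$ For $d=2$ this number is $\frac{n+1}{2}\,C_n$. -/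

import Mathlib

namespace ReflFC

/-! ### The groups `G(d,1,n)` and `G(d,d,n)`

The generators `s_1, …, s_n` are indexed by `Fin n`: the index `i : Fin n` stands for the
generator with label `i.val + 1`. A defining relation `x = y` is encoded by the relator
`x * y⁻¹`. -/

/-- The relators of `G(d,1,n)`. -/
inductive Rel1 (d n : ℕ) : FreeGroup (Fin n) → Prop
  /-- `s_n ^ d = 1` -/
  | pow_last (t : Fin n) (ht : t.val + 1 = n) : Rel1 d n (.of t ^ d)
  /-- `s_i ^ 2 = 1` for `1 ≤ i ≤ n - 1` -/
  | sq (i : Fin n) (hi : i.val + 1 < n) : Rel1 d n (.of i ^ 2)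
  /-- `s_i s_j = s_j s_i` for `j + 1 < i ≤ n` -/
  | comm (i j : Fin n) (hij : j.val + 1 < i.val) :
      Rel1 d n ((.of i * .of j) * (.of j * .of i)⁻¹)
  /-- `s_{i+1} s_i s_{i+1} = s_i s_{i+1} s_i` for `1 ≤ i ≤ n - 2` -/
  | braid (i j : Fin n) (hij : j.val = i.val + 1) (hj : j.val + 1 < n) :
      Rel1 d n ((.of j * .of i * .of j) * (.of i * .of j * .of i)⁻¹)
  /-- `s_n s_{n-1} s_n s_{n-1} = s_{n-1} s_n s_{n-1} s_n` -/
  | braid_last (t a : Fin n) (ht : t.val + 1 = n) (ha : a.val + 2 = n) :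
      Rel1 d n ((.of t * .of a * .of t * .of a) * (.of a * .of t * .of a * .of t)⁻¹)

/-- The complex reflection group `G(d,1,n)`. -/
abbrev G1 (d n : ℕ) : Type := PresentedGroup {r : FreeGroup (Fin n) | Rel1 d n r}

/-- The generators of `G(d,1,n)`. -/
def s (d n : ℕ) (i : Fin n) : G1 d n := PresentedGroup.of i

/-- The relators of `G(d,d,n)`. -/
inductive RelD (d n : ℕ) : FreeGroup (Fin n) → Prop
  /-- `s̃_i ^ 2 = 1` for `1 ≤ i ≤ n` -/
  | sq (i : Fin n) : RelD d n (.of i ^ 2)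
  /-- `(s̃_n s̃_{n-1}) ^ d = 1` -/
  | pow_last (t a : Fin n) (ht : t.val + 1 = n) (ha : a.val + 2 = n) :
      RelD d n ((.of t * .of a) ^ d)
  /-- `s̃_i s̃_j = s̃_j s̃_i` for `j + 1 < i ≤ n - 1` -/
  | comm (i j : Fin n) (hij : j.val + 1 < i.val) (hi : i.val + 1 < n) :
      RelD d n ((.of i * .of j) * (.of j * .of i)⁻¹)
  /-- `s̃_n s̃_j = s̃_j s̃_n` for `j ≤ n - 3` -/
  | comm_last (t j : Fin n) (ht : t.val + 1 = n) (hj : j.val + 1 + 3 ≤ n) :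
      RelD d n ((.of t * .of j) * (.of j * .of t)⁻¹)
  /-- `s̃_{i+1} s̃_i s̃_{i+1} = s̃_i s̃_{i+1} s̃_i` for `1 ≤ i ≤ n - 2` -/
  | braid (i j : Fin n) (hij : j.val = i.val + 1) (hj : j.val + 1 < n) :
      RelD d n ((.of j * .of i * .of j) * (.of i * .of j * .of i)⁻¹)
  /-- `s̃_n s̃_{n-2} s̃_n = s̃_{n-2} s̃_n s̃_{n-2}` -/
  | braid_last (t b : Fin n) (ht : t.val + 1 = n) (hb : b.val + 3 = n) :
      RelD d n ((.of t * .of b * .of t) * (.of b * .of t * .of b)⁻¹)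
  /-- `(s̃_n s̃_{n-1} s̃_{n-2}) ^ 2 = (s̃_{n-2} s̃_n s̃_{n-1}) ^ 2` -/
  | triangle (t a b : Fin n) (ht : t.val + 1 = n) (ha : a.val + 2 = n) (hb : b.val + 3 = n) :
      RelD d n ((.of t * .of a * .of b) ^ 2 * ((.of b * .of t * .of a) ^ 2)⁻¹)

/-- The complex reflection group `G(d,d,n)`. -/
abbrev GD (d n : ℕ) : Type := PresentedGroup {r : FreeGroup (Fin n) | RelD d n r}

/-! ### The embedding `ι : G(d,d,n) → G(d,1,n)` -/

/-- The images of the generators: `s̃_n ↦ s_n ^ (d-1) s_{n-1} s_n` and `s̃_i ↦ s_i` for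
`1 ≤ i ≤ n - 1`. -/
def iotaGen (d n : ℕ) (i : Fin n) : G1 d n :=
  if i.val + 1 = n then
    s d n i ^ (d - 1) * s d n ⟨i.val - 1, lt_of_le_of_lt (Nat.sub_le _ _) i.isLt⟩ * s d n i
  else s d n i

theorem s_rel {d n : ℕ} {r : FreeGroup (Fin n)} (h : Rel1 d n r) :
    FreeGroup.lift (s d n) r = 1 := by
  have h1 : FreeGroup.lift (s d n) = PresentedGroup.mk {r : FreeGroup (Fin n) | Rel1 d n r} := by
    ext i
    simp [s, PresentedGroup.of]
  rw [h1]
  exact PresentedGroup.one_of_mem h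

theorem iotaGen_of_lt {d n : ℕ} {i : Fin n} (h : i.val + 1 < n) : iotaGen d n i = s d n i := by
  simp [iotaGen, h.ne]

/-- The generator relations of `G(d,1,n)` as equations between group elements. -/
theorem s_pow_last {d n : ℕ} {t : Fin n} (ht : t.val + 1 = n) : s d n t ^ d = 1 := by
  simpa using s_rel (Rel1.pow_last (d := d) t ht)

theorem s_sq {d n : ℕ} {i : Fin n} (hi : i.val + 1 < n) : s d n i * s d n i = 1 := by
  simpa [pow_two] using s_rel (Rel1.sq (d := d) i hi)

theorem s_comm {d n : ℕ} {i j : Fin n} (hij : j.val + 1 < i.val) :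
    s d n i * s d n j = s d n j * s d n i := by
  have := s_rel (Rel1.comm (d := d) i j hij)
  simp only [map_mul, map_inv, FreeGroup.lift_apply_of] at this
  exact mul_inv_eq_one.mp this

theorem s_braid {d n : ℕ} {i j : Fin n} (hij : j.val = i.val + 1) (hj : j.val + 1 < n) :
    s d n j * s d n i * s d n j = s d n i * s d n j * s d n i := by
  have := s_rel (Rel1.braid (d := d) i j hij hj)
  simp only [map_mul, map_inv, FreeGroup.lift_apply_of] at this
  exact mul_inv_eq_one.mp this

theorem s_braid_last {d n : ℕ} {t a : Fin n} (ht : t.val + 1 = n) (ha : a.val + 2 = n) :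
    s d n t * s d n a * s d n t * s d n a = s d n a * s d n t * s d n a * s d n t := by
  have := s_rel (Rel1.braid_last (d := d) t a ht ha)
  simp only [map_mul, map_inv, FreeGroup.lift_apply_of] at this
  exact mul_inv_eq_one.mp this

theorem iotaGen_last {d n : ℕ} (hd : 2 ≤ d) {t a : Fin n} (ht : t.val + 1 = n)
    (ha : a.val + 2 = n) : iotaGen d n t = (s d n t)⁻¹ * s d n a * s d n t := by
  have h1 : (⟨t.val - 1, lt_of_le_of_lt (Nat.sub_le _ _) t.isLt⟩ : Fin n) = a := by
    ext; simp; omega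
  have h2 : s d n t ^ (d - 1) = (s d n t)⁻¹ := by
    rw [eq_inv_iff_mul_eq_one, ← pow_succ, Nat.sub_add_cancel (by omega), s_pow_last ht]
  simp only [iotaGen, ht, if_true, h1, h2]

theorem triangle_aux {G : Type*} [Group G] {t a b : G} (haa : a * a = 1) (hbb : b * b = 1)
    (htb : t * b = b * t) (hab : a * b * a = b * a * b)
    (hta : t * a * t * a = a * t * a * t) :
    (t⁻¹ * a * t * a * b) ^ 2 = (b * (t⁻¹ * a * t) * a) ^ 2 := by
  have ha : a⁻¹ = a := inv_eq_of_mul_eq_one_left haa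
  have hb : b⁻¹ = b := inv_eq_of_mul_eq_one_left hbb
  -- the three commuting conjugates of `t`
  have c12 : Commute t (a * t * a) := by
    show t * (a * t * a) = (a * t * a) * t
    simpa only [mul_assoc] using hta
  have ctb : Commute t b := htb
  have e1 : b * t * b = t := by rw [← htb, mul_assoc, hbb, mul_one]
  have c13 : Commute t (b * (a * t * a) * b) := by
    have := (ctb.mul_right c12).mul_right ctb
    simpa only [mul_assoc] using this
  have c23 : Commute (a * t * a) (b * (a * t * a) * b) := by
    have h3 : a * (b * (a * t * a) * b) * a = b * (a * t * a) * b := by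
      calc a * (b * (a * t * a) * b) * a = (a * b * a) * t * (a * b * a) := by group
        _ = (b * a * b) * t * (b * a * b) := by rw [hab]
        _ = b * a * (b * t * b) * a * b := by group
        _ = b * (a * t * a) * b := by rw [e1]; group
    show a * t * a * (b * (a * t * a) * b) = b * (a * t * a) * b * (a * t * a)
    calc a * t * a * (b * (a * t * a) * b)
        = a * t * a * (a * (b * (a * t * a) * b) * a) := by rw [h3]
      _ = a * t * (a * a) * (b * (a * t * a) * b) * a := by group
      _ = a * (t * (b * (a * t * a) * b)) * a := by rw [haa]; group
      _ = a * ((b * (a * t * a) * b) * t) * a := by rw [c13.eq]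
      _ = a * (b * (a * t * a) * b) * (a * a) * t * a := by rw [haa]; group
      _ = (a * (b * (a * t * a) * b) * a) * (a * t * a) := by group
      _ = b * (a * t * a) * b * (a * t * a) := by rw [h3]
  have hc : Commute (t⁻¹ * (a * t * a)) (t⁻¹ * (b * (a * t * a) * b)) := by
    refine Commute.mul_left ?_ ?_
    · exact ((Commute.refl t).inv_right.mul_right c13).inv_left
    · exact (c12.symm.inv_right).mul_right c23
  have hbt : b * t⁻¹ * b = t⁻¹ := by
    have : b * t⁻¹ = t⁻¹ * b := (ctb.inv_left).eq.symm
    rw [this, mul_assoc, hbb, mul_one]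
  have hx : b * (t⁻¹ * (a * t * a)) * b = t⁻¹ * (b * (a * t * a) * b) := by
    have : b * t⁻¹ = t⁻¹ * b := (ctb.inv_left).eq.symm
    calc b * (t⁻¹ * (a * t * a)) * b = (b * t⁻¹) * (a * t * a) * b := by group
      _ = t⁻¹ * (b * (a * t * a) * b) := by rw [this]; group
  rw [← hx] at hc
  have h := hc.eq
  calc (t⁻¹ * a * t * a * b) ^ 2
      = t⁻¹ * (a * t * a) * (b * (t⁻¹ * (a * t * a)) * b) := by rw [pow_two]; group
    _ = b * (t⁻¹ * (a * t * a)) * b * (t⁻¹ * (a * t * a)) := h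
    _ = (b * (t⁻¹ * a * t) * a) ^ 2 := by rw [pow_two]; group

theorem pow_aux {G : Type*} [Group G] {t a : G} {d : ℕ} (haa : a * a = 1) (htd : t ^ d = 1)
    (hta : t * a * t * a = a * t * a * t) : (t⁻¹ * a * t * a) ^ d = 1 := by
  have ha : a⁻¹ = a := inv_eq_of_mul_eq_one_left haa
  have c12 : Commute t (a * t * a⁻¹) := by
    show t * (a * t * a⁻¹) = (a * t * a⁻¹) * t
    rw [ha]
    simpa only [mul_assoc] using hta
  have e : t⁻¹ * a * t * a = t⁻¹ * (a * t * a⁻¹) := by rw [ha]; group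
  rw [e, (c12.inv_left).mul_pow, conj_pow, inv_pow, htd]
  simp

/-- `ι` respects the defining relations of `G(d,d,n)`. -/
theorem iotaGen_rel {d n : ℕ} (hd : 2 ≤ d) (hn : 3 ≤ n) :
    ∀ r ∈ {r : FreeGroup (Fin n) | RelD d n r}, FreeGroup.lift (iotaGen d n) r = 1 := by
  intro r hr
  cases hr with
  | sq i =>
    simp only [map_pow, FreeGroup.lift_apply_of]
    by_cases hi : i.val + 1 < n
    · rw [iotaGen_of_lt hi, pow_two, s_sq hi]
    · have ht : i.val + 1 = n := by have := i.isLt; omega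
      have ha : (⟨n - 2, by omega⟩ : Fin n).val + 2 = n := by simp; omega
      have haa := s_sq (d := d) (i := (⟨n - 2, by omega⟩ : Fin n)) (by simp; omega)
      rw [iotaGen_last hd ht ha]
      calc _ = (s d n i)⁻¹ * (s d n ⟨n - 2, by omega⟩ * s d n ⟨n - 2, by omega⟩) * s d n i := by
            rw [pow_two]; group
        _ = 1 := by rw [haa]; group
  | pow_last t a ht ha =>
    simp only [map_pow, map_mul, FreeGroup.lift_apply_of]
    rw [iotaGen_last hd ht ha, iotaGen_of_lt (by omega)]
    exact pow_aux (s_sq (by omega)) (s_pow_last ht) (s_braid_last ht ha)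
  | comm i j hij hi =>
    simp only [map_mul, map_inv, FreeGroup.lift_apply_of]
    rw [iotaGen_of_lt hi, iotaGen_of_lt (by omega), s_comm hij, mul_inv_cancel]
  | comm_last t j ht hj =>
    simp only [map_mul, map_inv, FreeGroup.lift_apply_of]
    have ha : (⟨n - 2, by omega⟩ : Fin n).val + 2 = n := by simp; omega
    rw [iotaGen_last hd ht ha, iotaGen_of_lt (by omega), mul_inv_eq_one]
    have h1 : Commute (s d n t) (s d n j) := s_comm (by omega)
    have h2 : Commute (s d n ⟨n - 2, by omega⟩) (s d n j) := s_comm (by simp; omega)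
    exact ((h1.inv_left.mul_left h2).mul_left h1).eq
  | braid i j hij hj =>
    simp only [map_mul, map_inv, FreeGroup.lift_apply_of]
    rw [iotaGen_of_lt hj, iotaGen_of_lt (by omega), s_braid hij hj, mul_inv_cancel]
  | braid_last t b ht hb =>
    simp only [map_mul, map_inv, FreeGroup.lift_apply_of]
    have ha : (⟨n - 2, by omega⟩ : Fin n).val + 2 = n := by simp; omega
    rw [iotaGen_last hd ht ha, iotaGen_of_lt (by omega), mul_inv_eq_one]
    have h1 : s d n t * s d n b = s d n b * s d n t := s_comm (by omega)
    have h2 := s_braid (d := d) (i := b) (j := ⟨n - 2, by omega⟩) (by simp; omega) (by simp; omega)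
    have h3 : s d n t * s d n b * (s d n t)⁻¹ = s d n b := by rw [h1]; group
    have h4 : (s d n t)⁻¹ * s d n b * s d n t = s d n b := by rw [mul_assoc, ← h1]; group
    generalize s d n ⟨n - 2, by omega⟩ = a at *
    generalize s d n t = t' at *
    generalize s d n b = b' at *
    calc t'⁻¹ * a * t' * b' * (t'⁻¹ * a * t') = t'⁻¹ * a * (t' * b' * t'⁻¹) * a * t' := by group
      _ = t'⁻¹ * (a * b' * a) * t' := by rw [h3]; group
      _ = (t'⁻¹ * b' * t') * (t'⁻¹ * a * t') * (t'⁻¹ * b' * t') := by rw [h2]; group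
      _ = b' * (t'⁻¹ * a * t') * b' := by rw [h4]
  | triangle t a b ht ha hb =>
    simp only [map_pow, map_mul, map_inv, FreeGroup.lift_apply_of]
    rw [iotaGen_last hd ht ha, iotaGen_of_lt (i := a) (by omega),
      iotaGen_of_lt (i := b) (by omega), mul_inv_eq_one]
    exact triangle_aux (s_sq (by omega)) (s_sq (by omega)) (s_comm (by omega))
      (s_braid (by omega) (by omega)) (s_braid_last ht ha)

/-- The homomorphism `ι : G(d,d,n) → G(d,1,n)`. -/
def iota (d n : ℕ) (hd : 2 ≤ d) (hn : 3 ≤ n) : GD d n →* G1 d n :=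
  PresentedGroup.toGroup (iotaGen_rel hd hn)

/-! ### Words, reduced words and full commutativity -/

/-- The element of `G(d,1,n)` represented by a word in the generators. -/
def eval (d n : ℕ) (w : List (Fin n)) : G1 d n := (w.map (s d n)).prod

/-- `R(g)`: the words of minimal length among the words in the generators (no inverses)
representing `g`. -/
def reducedWords (d n : ℕ) (g : G1 d n) : Set (List (Fin n)) :=
  {w | eval d n w = g ∧ ∀ v : List (Fin n), eval d n v = g → w.length ≤ v.length}

/-- One application of a relation `s_i s_j → s_j s_i`, `j + 1 < i`, inside a word. -/
inductive CommStep {n : ℕ} : List (Fin n) → List (Fin n) → Prop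
  | swap (u v : List (Fin n)) (i j : Fin n) (hij : j.val + 1 < i.val) :
      CommStep (u ++ [i, j] ++ v) (u ++ [j, i] ++ v)

/-- The relation `∼` on words generated by the commutation relations. -/
def CommEquiv {n : ℕ} : List (Fin n) → List (Fin n) → Prop := Relation.EqvGen CommStep

/-- `g` is fully commutative if `R(g)` consists of a single commutativity class. -/
def FullyCommutative (d n : ℕ) (g : G1 d n) : Prop :=
  ∃ w₀, reducedWords d n g = {w | CommEquiv w₀ w}

/-- The fully commutative elements of `G(d,d,n)`: those whose image under `ι` is fully
commutative in `G(d,1,n)`. -/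
def fcElements (d n : ℕ) (hd : 2 ≤ d) (hn : 3 ≤ n) : Set (GD d n) :=
  {g | FullyCommutative d n (iota d n hd hn g)}

/-! ### Canonical words, collections and packets -/

/-- The word `s_{ij} = [i, i-1, …, j]` (labels are 1-based), which is empty if `i < j`. -/
def desc (n i j : ℕ) : List (Fin n) :=
  ((List.finRange n).filter fun p => j ≤ p.val + 1 ∧ p.val + 1 ≤ i).reverse

/-- The word `s_{nj}^{(k)} = s_n ^ k s_{n-1,j}`. -/
def descPow (n k j : ℕ) : List (Fin n) :=
  (List.replicate k (desc n n n)).flatten ++ desc n (n - 1) j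

/-- `w` is a prefix `s_{1 i_1} s_{2 i_2} ⋯ s_{n-1, i_{n-1}}` with `1 ≤ i_p ≤ p + 1`. -/
def IsPrefix (n : ℕ) (w : List (Fin n)) : Prop :=
  ∃ i : ℕ → ℕ, (∀ p, 1 ≤ p → p ≤ n - 1 → 1 ≤ i p ∧ i p ≤ p + 1) ∧
    w = ((List.range (n - 1)).map fun p => desc n (p + 1) (i (p + 1))).flatten

/-- The data `(j_1, k_1), …, (j_ℓ, k_ℓ)` of a suffix: `1 ≤ j_1 < ⋯ < j_ℓ ≤ n` and
`1 ≤ k_p ≤ d - 1`. -/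
def IsSuffixData (d n : ℕ) (L : List (ℕ × ℕ)) : Prop :=
  (L.map Prod.fst).Pairwise (· < ·) ∧
    ∀ x ∈ L, (1 ≤ x.1 ∧ x.1 ≤ n) ∧ (1 ≤ x.2 ∧ x.2 ≤ d - 1)

/-- The suffix `s_{n j_1}^{(k_1)} ⋯ s_{n j_ℓ}^{(k_ℓ)}`. -/
def suffixWord (n : ℕ) (L : List (ℕ × ℕ)) : List (Fin n) :=
  (L.map fun x => descPow n x.2 x.1).flatten

/-- The collection labeled by the suffix `w'`: the canonical words of `G(d,1,n)` with suffix `w'`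
that represent fully commutative elements. -/
def collection (d n : ℕ) (w' : List (Fin n)) : Set (List (Fin n)) :=
  {w | ∃ w₀, IsPrefix n w₀ ∧ w = w₀ ++ w' ∧ FullyCommutative d n (eval d n w)}

/-- The suffixes labeling the collections of the `(n,k)`-packet of `G(d,1,n)`, given by their data:
* `k = n`: the empty suffix;
* `k = n - 1`: `s_n ^ t` and `s_{n,n-1}^{(t)}`;
* `k ≤ n - 2`: the suffixes with `ℓ ≥ 2` and `j_1 = k + 1`, and, if `1 ≤ k`,
  the suffixes `s_{nk}^{(t)}`. -/
def IsPacketLabel (n k : ℕ) (L : List (ℕ × ℕ)) : Prop :=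
  (k = n ∧ L = []) ∨
  (k + 1 = n ∧ ∃ t, L = [(n, t)] ∨ L = [(n - 1, t)]) ∨
  (k + 2 ≤ n ∧ ∃ t x L', L = (k + 1, t) :: x :: L') ∨
  (k + 2 ≤ n ∧ 1 ≤ k ∧ ∃ t, L = [(k, t)])

/-- The `(n,k)`-packet of `G(d,1,n)`, a set of collections. -/
def packet1 (d n k : ℕ) : Set (Set (List (Fin n))) :=
  {c | ∃ L, IsSuffixData d n L ∧ IsPacketLabel n k L ∧ c = collection d n (suffixWord n L)}

/-- The `(n,k)`-packet of `G(d,d,n)`: the collections in the `(n,k)`-packet of `G(d,1,n)` which are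
contained in `G(d,d,n)`, identified with the image of `ι`. -/
def packetD (d n k : ℕ) (hd : 2 ≤ d) (hn : 3 ≤ n) : Set (Set (List (Fin n))) :=
  {c | c ∈ packet1 d n k ∧ ∀ w ∈ c, eval d n w ∈ (iota d n hd hn).range}

/-! ### Catalan triangle -/

/-- The Catalan triangle number `C(n,k) = (n+k)! (n-k+1) / (k! (n+1)!)`, for `0 ≤ k ≤ n`. -/
def catalanTriangle (n k : ℕ) : ℚ :=
  ((n + k).factorial * ((n : ℚ) - k + 1)) / (k.factorial * (n + 1).factorial)

/-- The Catalan triangle polynomial `𝔉_{n,k}(x) = ∑_{s=0}^k C(n,s) x^{k-s}`. -/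
noncomputable def catalanPoly (n k : ℕ) : Polynomial ℚ :=
  ∑ j ∈ Finset.range (k + 1), Polynomial.C (catalanTriangle n j) * Polynomial.X ^ (k - j)

end ReflFC

/-! The generators act on the colored points `(q, c)`, with `c` in `ZMod d`: `s_i` exchanges the
points `i` and `i + 1`, and `s_n` adds `1` to the color of `n`. A canonical word is a prefix, which
is a normal form in the symmetric group, followed by a suffix encoded by colors `c_1, …, c_n`, a
zero color giving an empty block.

Rewriting: a canonical word times a letter becomes canonical again by commutations, braid moves and
shortenings (`exists_reduces_canonicalWord`). The action on colored points recovers the prefix and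
the colors (`canonicalWord_injective`). Hence canonical words are reduced and represent each element
once, and every reduced word is joined to its canonical word by moves that preserve length, as in
Matsumoto's theorem.

Full commutativity: the two sides of a braid move are never commutation equivalent, so an element is
fully commutative exactly when no word in the commutativity class of its canonical word admits a
braid move. Let `κ + 1` be the position of the first nonzero color, with `κ = n` if there is none.
If the nonempty prefix blocks `s_{m i}` have strictly increasing `i ≤ κ`, then the word is
`Separated`, which excludes braid moves (`fullyCommutative_canonicalWord`). Conversely, a violation
produces a braid move as soon as the colors sum to zero (`allowedPrefix_of_fullyCommutative`).

The group `G(d,d,n)`: conjugation by `s_n⁻¹` comes from an automorphism of `G(d,d,n)`, so `G(d,1,n)`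
maps to the holomorph of `G(d,d,n)`, which proves that `ι` is injective. Its image consists of the
elements whose words contain `s_n` a multiple of `d` times; for canonical words this says that the
colors sum to zero.

Counting: for a given `κ = k` there are `C(n,k)` admissible prefixes, by the recursion of the
Catalan triangle. The color lists with sum zero number `1` for `k = n`, `0` for `k = n - 1` (a
single nonzero color cannot sum to zero) and `(d - 1) d^(n-k-2)` otherwise. These lists label the
collections in `P(n,k)`, and summing over `k` gives the formulas. -/

namespace ReflFC

/-! ### Words and braid moves -/

section Words

variable {d n : ℕ}

theorem mem_desc {i j : ℕ} {p : Fin n} : p ∈ desc n i j ↔ j ≤ p.val + 1 ∧ p.val + 1 ≤ i := by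
  simp [desc]

theorem desc_sorted (i j : ℕ) : (desc n i j).SortedGT := by
  have h : (List.finRange n).Pairwise (· < ·) := List.pairwise_lt_finRange n
  have := List.Pairwise.filter (fun p : Fin n => decide (j ≤ p.val + 1 ∧ p.val + 1 ≤ i)) h
  rw [List.sortedGT_iff_pairwise, desc, List.pairwise_reverse]
  exact this

theorem desc_split {i j m : ℕ} (h1 : j ≤ m + 1) (h2 : m ≤ i) :
    desc n i j = desc n i (m + 1) ++ desc n m j := by
  refine (desc_sorted i j).eq_of_mem_iff ?_ fun p => ?_
  · rw [List.sortedGT_iff_pairwise, List.pairwise_append]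
    refine ⟨(desc_sorted _ _).pairwise, (desc_sorted _ _).pairwise, fun a ha b hb => ?_⟩
    rw [mem_desc] at ha hb
    exact Fin.lt_def.2 (by omega)
  · simp only [List.mem_append, mem_desc]
    omega

theorem desc_nil {i j : ℕ} (h : i < j) : desc n i j = [] := by
  rw [List.eq_nil_iff_forall_not_mem]
  intro p hp
  rw [mem_desc] at hp
  omega

theorem desc_self {x : ℕ} (h1 : 1 ≤ x) (h2 : x ≤ n) :
    desc n x x = [⟨x - 1, by omega⟩] := by
  refine (desc_sorted x x).eq_of_mem_iff (by simp [List.sortedGT_iff_pairwise]) fun p => ?_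
  simp only [mem_desc, List.mem_singleton, Fin.ext_iff]
  omega

theorem desc_cons {i j : ℕ} (h1 : j ≤ i + 1) :
    desc n (i + 1) j = desc n (i + 1) (i + 1) ++ desc n i j :=
  desc_split h1 (Nat.le_succ i)

theorem desc_snoc {i j : ℕ} (h1 : j ≤ i) :
    desc n i j = desc n i (j + 1) ++ desc n j j :=
  desc_split (Nat.le_succ j) h1

/-- A braid relation of type `A`, or a relation `a t^k a t = t a t^k a`, inside a word. -/
inductive BraidStep {n : ℕ} : List (Fin n) → List (Fin n) → Prop
  | braid (u v : List (Fin n)) (i j : Fin n) (hij : j.val = i.val + 1) (hj : j.val + 1 < n) :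
      BraidStep (u ++ [i, j, i] ++ v) (u ++ [j, i, j] ++ v)
  | last (u v : List (Fin n)) (t a : Fin n) (k : ℕ) (ht : t.val + 1 = n) (ha : a.val + 2 = n) :
      BraidStep (u ++ ([a] ++ List.replicate k t ++ [a, t]) ++ v)
        (u ++ ([t, a] ++ List.replicate k t ++ [a]) ++ v)

/-- A commutation or a braid move. -/
def WordMove (u v : List (Fin n)) : Prop := CommStep u v ∨ BraidStep u v

/-- Two words are connected by commutations and braid moves. -/
def WordEquiv : List (Fin n) → List (Fin n) → Prop := Relation.EqvGen WordMove

theorem CommStep.context {u v : List (Fin n)} (x y : List (Fin n)) (h : CommStep u v) :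
    CommStep (x ++ u ++ y) (x ++ v ++ y) := by
  obtain ⟨u, v, i, j, hij⟩ := h
  simpa only [List.append_assoc] using CommStep.swap (x ++ u) (v ++ y) i j hij

theorem BraidStep.context {u v : List (Fin n)} (x y : List (Fin n)) (h : BraidStep u v) :
    BraidStep (x ++ u ++ y) (x ++ v ++ y) := by
  cases h with
  | braid u v i j hij hj =>
    simpa only [List.append_assoc] using BraidStep.braid (x ++ u) (v ++ y) i j hij hj
  | last u v t a k ht ha =>
    simpa only [List.append_assoc] using BraidStep.last (x ++ u) (v ++ y) t a k ht ha

theorem eqvGen_context {r : List (Fin n) → List (Fin n) → Prop} (x y : List (Fin n))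
    (hr : ∀ u v, r u v → r (x ++ u ++ y) (x ++ v ++ y)) {u v : List (Fin n)}
    (h : Relation.EqvGen r u v) : Relation.EqvGen r (x ++ u ++ y) (x ++ v ++ y) := by
  induction h with
  | rel u v h => exact .rel _ _ (hr _ _ h)
  | refl u => exact .refl _
  | symm u v _ ih => exact .symm _ _ ih
  | trans u v w _ _ ih1 ih2 => exact .trans _ _ _ ih1 ih2

theorem CommEquiv.context {u v : List (Fin n)} (x y : List (Fin n)) (h : CommEquiv u v) :
    CommEquiv (x ++ u ++ y) (x ++ v ++ y) :=
  eqvGen_context x y (fun _ _ h => h.context x y) h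

namespace WordEquiv

theorem context {u v : List (Fin n)} (x y : List (Fin n)) (h : WordEquiv u v) :
    WordEquiv (x ++ u ++ y) (x ++ v ++ y) :=
  eqvGen_context x y (fun _ _ h => h.imp (·.context x y) (·.context x y)) h

theorem refl (u : List (Fin n)) : WordEquiv u u := Relation.EqvGen.refl _

theorem symm {u v : List (Fin n)} (h : WordEquiv u v) : WordEquiv v u := Relation.EqvGen.symm _ _ h

theorem trans {u v w : List (Fin n)} (h : WordEquiv u v) (h' : WordEquiv v w) : WordEquiv u w :=
  Relation.EqvGen.trans _ _ _ h h'

instance : Trans (WordEquiv (n := n)) (WordEquiv (n := n)) (WordEquiv (n := n)) := ⟨trans⟩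

theorem append {u u' v v' : List (Fin n)} (h : WordEquiv u u') (h' : WordEquiv v v') :
    WordEquiv (u ++ v) (u' ++ v') := by
  have h1 := h.context [] v
  have h2 := h'.context u' []
  simp only [List.nil_append, List.append_nil] at h1 h2
  exact h1.trans h2

theorem append_left {v v' : List (Fin n)} (u : List (Fin n)) (h' : WordEquiv v v') :
    WordEquiv (u ++ v) (u ++ v') := (refl u).append h'

theorem append_right {u u' : List (Fin n)} (h : WordEquiv u u') (v : List (Fin n)) :
    WordEquiv (u ++ v) (u' ++ v) := h.append (refl v)

theorem of_comm {u v : List (Fin n)} (h : CommEquiv u v) : WordEquiv u v :=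
  Relation.EqvGen.mono (fun _ _ h => Or.inl h) _ _ h

end WordEquiv

namespace CommEquiv

theorem refl (u : List (Fin n)) : CommEquiv u u := Relation.EqvGen.refl _

theorem symm {u v : List (Fin n)} (h : CommEquiv u v) : CommEquiv v u := Relation.EqvGen.symm _ _ h

theorem trans {u v w : List (Fin n)} (h : CommEquiv u v) (h' : CommEquiv v w) : CommEquiv u w :=
  Relation.EqvGen.trans _ _ _ h h'

theorem append {u u' v v' : List (Fin n)} (h : CommEquiv u u') (h' : CommEquiv v v') :
    CommEquiv (u ++ v) (u' ++ v') := by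
  have h1 := h.context [] v
  have h2 := h'.context u' []
  simp only [List.nil_append, List.append_nil] at h1 h2
  exact h1.trans h2

theorem append_left {v v' : List (Fin n)} (u : List (Fin n)) (h' : CommEquiv v v') :
    CommEquiv (u ++ v) (u ++ v') := (refl u).append h'

theorem append_right {u u' : List (Fin n)} (h : CommEquiv u u') (v : List (Fin n)) :
    CommEquiv (u ++ v) (u' ++ v) := h.append (refl v)

theorem pair {p q : Fin n} (h : p.val + 1 < q.val ∨ q.val + 1 < p.val) :
    CommEquiv [p, q] [q, p] := by
  rcases h with h | h
  · exact symm (.rel _ _ (by simpa using CommStep.swap [] [] q p h))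
  · exact .rel _ _ (by simpa using CommStep.swap [] [] p q h)

theorem swap_letter {w : List (Fin n)} {q : Fin n}
    (h : ∀ p ∈ w, p.val + 1 < q.val ∨ q.val + 1 < p.val) : CommEquiv (w ++ [q]) ([q] ++ w) := by
  induction w with
  | nil => exact refl _
  | cons p w ih =>
    have h1 := (ih fun p hp => h p (List.mem_cons_of_mem _ hp)).append_left [p]
    have h2 := (pair (h p List.mem_cons_self)).append_right w
    exact h1.trans h2

theorem swap {w v : List (Fin n)}
    (h : ∀ p ∈ w, ∀ q ∈ v, p.val + 1 < q.val ∨ q.val + 1 < p.val) :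
    CommEquiv (w ++ v) (v ++ w) := by
  induction v with
  | nil => simpa using refl _
  | cons q v ih =>
    have h1 := (swap_letter fun p hp => h p hp q List.mem_cons_self).append_right v
    have h2 := (ih fun p hp q hq => h p hp q (List.mem_cons_of_mem _ hq)).append_left [q]
    simpa using (trans (by simpa using h1) (by simpa using h2))

end CommEquiv

/-! ### Evaluation of words -/

theorem eval_append (u v : List (Fin n)) : eval d n (u ++ v) = eval d n u * eval d n v := by
  simp [eval]

theorem eval_replicate (k : ℕ) (p : Fin n) : eval d n (List.replicate k p) = s d n p ^ k := by
  simp [eval]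

/-- The relation of length four says that `a t a` commutes with `t`, and `a t^k a = (a t a)^k`
because `a` is an involution. For `k ≥ 2` the identity does not follow from the positive braid
relation alone, which is why the whole family in `k` is admitted among the braid moves. -/
theorem braid_pow {G : Type*} [Group G] {t a : G} (haa : a * a = 1)
    (hta : t * a * t * a = a * t * a * t) (k : ℕ) : a * t ^ k * a * t = t * a * t ^ k * a := by
  have ha : a⁻¹ = a := inv_eq_of_mul_eq_one_left haa
  have c : Commute (a * t * a⁻¹) t := by
    show (a * t * a⁻¹) * t = t * (a * t * a⁻¹)
    rw [ha, ← hta]; group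
  have := (c.pow_left k).eq
  rw [conj_pow, ha] at this
  rw [this]; group

theorem eval_commStep {u v : List (Fin n)} (h : CommStep u v) : eval d n u = eval d n v := by
  obtain ⟨u, v, i, j, hij⟩ := h
  have : eval d n [i, j] = eval d n [j, i] := by simpa [eval] using s_comm (d := d) hij
  simp only [eval_append, this]

theorem eval_braidStep {u v : List (Fin n)} (h : BraidStep u v) : eval d n u = eval d n v := by
  cases h with
  | braid u v i j hij hj =>
    have := s_braid (d := d) hij hj
    simp only [eval_append]
    congr 2
    simpa [eval, mul_assoc] using this.symm
  | last u v t a k ht ha =>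
    have := braid_pow (s_sq (d := d) (i := a) (by omega)) (s_braid_last (d := d) ht ha) k
    simp only [eval_append, eval_replicate]
    congr 2
    simpa [eval, mul_assoc] using this

theorem WordEquiv.eval_eq {u v : List (Fin n)} (h : WordEquiv u v) : eval d n u = eval d n v := by
  induction h with
  | rel u v h => exact h.elim eval_commStep eval_braidStep
  | refl u => rfl
  | symm u v _ ih => exact ih.symm
  | trans u v w _ _ ih1 ih2 => exact ih1.trans ih2

theorem CommStep.perm {u v : List (Fin n)} (h : CommStep u v) : u.Perm v := by
  obtain ⟨u, v, i, j, hij⟩ := h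
  exact ((List.Perm.swap j i []).append_left u).append_right v

theorem BraidStep.length_eq {u v : List (Fin n)} (h : BraidStep u v) : u.length = v.length := by
  cases h
  · simp
  · simp; omega

theorem CommEquiv.perm {u v : List (Fin n)} (h : CommEquiv u v) : u.Perm v := by
  induction h with
  | rel u v h => exact h.perm
  | refl u => exact .refl _
  | symm u v _ ih => exact ih.symm
  | trans u v w _ _ ih1 ih2 => exact ih1.trans ih2

theorem WordEquiv.length_eq {u v : List (Fin n)} (h : WordEquiv u v) : u.length = v.length := by
  induction h with
  | rel u v h => exact h.elim (·.perm.length_eq) (·.length_eq)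
  | refl u => rfl
  | symm u v _ ih => exact ih.symm
  | trans u v w _ _ ih1 ih2 => exact ih1.trans ih2

/-- `u` can be rewritten to `v` without changing the element it represents, either by braid moves
or with a loss of length. -/
def Reduces (d : ℕ) (u v : List (Fin n)) : Prop :=
  eval d n u = eval d n v ∧ (WordEquiv u v ∨ v.length < u.length)

namespace Reduces

theorem of_equiv {u v : List (Fin n)} (h : WordEquiv u v) : Reduces d u v := ⟨h.eval_eq, .inl h⟩

theorem of_comm {u v : List (Fin n)} (h : CommEquiv u v) : Reduces d u v := of_equiv (.of_comm h)

theorem refl (u : List (Fin n)) : Reduces d u u := of_equiv (.refl u)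

theorem trans {u v w : List (Fin n)} (h : Reduces d u v) (h' : Reduces d v w) :
    Reduces d u w := by
  refine ⟨h.1.trans h'.1, ?_⟩
  rcases h.2 with h1 | h1 <;> rcases h'.2 with h2 | h2
  · exact .inl (h1.trans h2)
  · exact .inr (h1.length_eq ▸ h2)
  · exact .inr (h2.length_eq ▸ h1)
  · exact .inr (h2.trans h1)

theorem append {u u' v v' : List (Fin n)} (h : Reduces d u u') (h' : Reduces d v v') :
    Reduces d (u ++ v) (u' ++ v') := by
  refine ⟨by rw [eval_append, eval_append, h.1, h'.1], ?_⟩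
  have l1 : u'.length ≤ u.length := h.2.elim (fun h => h.length_eq.ge) (fun h => h.le)
  have l2 : v'.length ≤ v.length := h'.2.elim (fun h => h.length_eq.ge) (fun h => h.le)
  rcases h.2 with h1 | h1
  · rcases h'.2 with h2 | h2
    · exact .inl (h1.append h2)
    · exact .inr (by simp; omega)
  · exact .inr (by simp; omega)

theorem append_left {v v' : List (Fin n)} (u : List (Fin n)) (h' : Reduces d v v') :
    Reduces d (u ++ v) (u ++ v') := (refl u).append h'

theorem append_right {u u' : List (Fin n)} (h : Reduces d u u') (v : List (Fin n)) :
    Reduces d (u ++ v) (u' ++ v) := h.append (refl v)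

theorem sq {x : ℕ} (hx : x < n) : Reduces d (desc n x x ++ desc n x x) [] := by
  -- Labels start from `1`, so the word for the label `0` is empty.
  rcases Nat.eq_zero_or_pos x with rfl | h
  · have : desc n 0 0 = [] := by
      rw [List.eq_nil_iff_forall_not_mem]
      intro p hp
      rw [mem_desc] at hp
      omega
    rw [this]; exact refl _
  · rw [desc_self h hx.le]
    exact ⟨by simpa [eval] using s_sq (d := d) (by simp; omega), .inr (by simp)⟩

end Reduces

end Words

/-! ### Rewriting words to canonical words -/

section Rewriting

variable {d n : ℕ}

/-- The word `s_n ^ k`. -/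
def lastPow (n k : ℕ) : List (Fin n) := (List.replicate k (desc n n n)).flatten

theorem lastPow_succ (k : ℕ) : lastPow n (k + 1) = lastPow n k ++ desc n n n := by
  simp [lastPow, List.replicate_succ']

theorem lastPow_eq_replicate (hn : 1 ≤ n) (k : ℕ) :
    lastPow n k = List.replicate k ⟨n - 1, by omega⟩ := by
  induction k with
  | zero => simp [lastPow]
  | succ k ih => rw [lastPow_succ, ih, desc_self hn le_rfl, List.replicate_succ']

theorem mem_lastPow {k : ℕ} {p : Fin n} (h : p ∈ lastPow n k) : p.val + 1 = n := by
  simp only [lastPow, List.mem_flatten, List.mem_replicate] at h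
  obtain ⟨l, ⟨_, rfl⟩, h⟩ := h
  rw [mem_desc] at h
  omega

theorem descPow_eq (k j : ℕ) : descPow n k j = lastPow n k ++ desc n (n - 1) j := rfl

theorem mem_descPow {k j : ℕ} {p : Fin n} (h : p ∈ descPow n k j) (hj : j ≤ n) :
    j ≤ p.val + 1 := by
  rw [descPow_eq, List.mem_append] at h
  rcases h with h | h
  · have := mem_lastPow h; omega
  · rw [mem_desc] at h; omega

theorem desc_comm_letter {i j x : ℕ} (h : x + 1 < j ∨ i + 1 < x) :
    CommEquiv (desc n i j ++ desc n x x) (desc n x x ++ desc n i j) := by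
  refine CommEquiv.swap fun p hp q hq => ?_
  rw [mem_desc] at hp hq
  omega

theorem lastPow_comm {k : ℕ} {w : List (Fin n)} (h : ∀ p ∈ w, p.val + 2 < n) :
    CommEquiv (lastPow n k ++ w) (w ++ lastPow n k) := by
  refine CommEquiv.swap fun p hp q hq => ?_
  have := mem_lastPow hp
  have := h q hq
  omega

theorem braid_letters {x : ℕ} (h1 : 1 ≤ x) (h2 : x + 1 < n) :
    WordEquiv (desc n (x + 1) (x + 1) ++ desc n x x ++ desc n (x + 1) (x + 1))
      (desc n x x ++ desc n (x + 1) (x + 1) ++ desc n x x) := by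
  rw [desc_self h1 (by omega), desc_self (x := x + 1) (by omega) (by omega)]
  refine WordEquiv.symm (.rel _ _ (.inr ?_))
  simpa using BraidStep.braid [] [] (⟨x - 1, by omega⟩ : Fin n) ⟨x + 1 - 1, by omega⟩
    (by simp; omega) (by simp; omega)

/-- The letter `s_x` commutes with `s_{x-2}, …, s_j`, is braided with `s_x s_{x-1}`, and comes out
as `s_{x-1}`, which commutes with `s_i, …, s_{x+1}`. Crossing a block thus lowers a label by one. -/
theorem desc_shift {i j x : ℕ} (hj : 1 ≤ j) (hx : j < x) (hxi : x ≤ i) (hi : i < n) :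
    WordEquiv (desc n i j ++ desc n x x) (desc n (x - 1) (x - 1) ++ desc n i j) := by
  obtain ⟨y, rfl⟩ : ∃ y, x = y + 1 := ⟨x - 1, by omega⟩
  obtain ⟨z, rfl⟩ : ∃ z, y = z + 1 := ⟨y - 1, by omega⟩
  have e1 : desc n i j = desc n i (z + 1 + 1 + 1) ++ desc n (z + 1 + 1) (z + 1 + 1) ++
      desc n (z + 1) (z + 1) ++ desc n z j := by
    rw [desc_split (i := i) (j := j) (m := z) (by omega) (by omega),
      desc_split (i := i) (j := z + 1) (m := z + 1) (by omega) (by omega),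
      desc_split (i := i) (j := z + 1 + 1) (m := z + 1 + 1) (by omega) (by omega)]
  simp only [Nat.add_sub_cancel]
  rw [e1]
  have h1 : WordEquiv (desc n z j ++ desc n (z + 1 + 1) (z + 1 + 1))
    (desc n (z + 1 + 1) (z + 1 + 1) ++ desc n z j) := .of_comm (desc_comm_letter (by omega))
  have h2 := braid_letters (n := n) (x := z + 1) (by omega) (by omega)
  have h3 : WordEquiv (desc n i (z + 1 + 1 + 1) ++ desc n (z + 1) (z + 1))
    (desc n (z + 1) (z + 1) ++ desc n i (z + 1 + 1 + 1)) := .of_comm (desc_comm_letter (by omega))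
  generalize desc n (z + 1 + 1) (z + 1 + 1) = b at *
  generalize desc n (z + 1) (z + 1) = a at *
  generalize desc n i (z + 1 + 1 + 1) = u at *
  generalize desc n z j = v at *
  have e2 := h1.append_left (u ++ b ++ a)
  have e3 := (h2.append_left u).append_right v
  have e4 := h3.append_right (b ++ a ++ v)
  simp only [List.append_assoc] at *
  exact e2.trans (e3.trans e4)

theorem descPow_shift {k j x : ℕ} (hj : 1 ≤ j) (hx : j < x) (hi : x < n) :
    WordEquiv (descPow n k j ++ desc n x x) (desc n (x - 1) (x - 1) ++ descPow n k j) := by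
  have h1 := (desc_shift (i := n - 1) hj hx (by omega) (by omega)).append_left (lastPow n k)
  have h2 : WordEquiv (lastPow n k ++ desc n (x - 1) (x - 1))
      (desc n (x - 1) (x - 1) ++ lastPow n k) := by
    refine .of_comm (lastPow_comm fun p hp => ?_)
    rw [mem_desc] at hp
    omega
  have h3 := h2.append_right (desc n (n - 1) j)
  simp only [descPow_eq, List.append_assoc] at *
  exact h1.trans h3

/-- Read from right to left, every letter of the last block crosses `s_{m+1,x}` by `desc_shift` and
drops by one, which turns `s_{m+1,x+1}` into `s_{m,x}`. -/
theorem desc_desc {m x : ℕ} (hx : 1 ≤ x) (hm : m + 1 < n) (hxm : x ≤ m + 1) :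
    WordEquiv (desc n m x ++ desc n (m + 1) x) (desc n (m + 1) x ++ desc n (m + 1) (x + 1)) := by
  have key : ∀ y, x ≤ y → y ≤ m + 1 →
      WordEquiv (desc n (m + 1) x ++ desc n (y + 1 - 1) (x + 1))
        (desc n (y - 1) x ++ desc n (m + 1) x) := by
    intro y hxy
    induction y, hxy using Nat.le_induction with
    | base =>
      intro _
      rw [desc_nil (by omega : x + 1 - 1 < x + 1), desc_nil (by omega : x - 1 < x)]
      simpa using WordEquiv.refl _
    | succ y hy ih =>
      intro hym
      have ih := ih (by omega)
      rw [Nat.add_sub_cancel] at *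
      rw [Nat.add_sub_cancel, desc_cons (i := y) (j := x + 1) (by omega)]
      have h1 := desc_shift (n := n) (i := m + 1) (j := x) (x := y + 1) hx (by omega) hym hm
      have h2 := h1.append_right (desc n y (x + 1))
      rw [Nat.add_sub_cancel] at h2
      have h3 := ih.append_left (desc n y y)
      obtain ⟨z, rfl⟩ : ∃ z, y = z + 1 := ⟨y - 1, by omega⟩
      rw [desc_cons (i := z) (j := x) (by omega)]
      simp only [List.append_assoc, Nat.add_sub_cancel] at *
      exact h2.trans h3
  have := key (m + 1) hxm le_rfl
  simp only [Nat.add_sub_cancel] at this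
  exact this.symm

theorem lastPow_braid (hn : 2 ≤ n) (k l : ℕ) :
    WordEquiv (lastPow n l ++ desc n (n - 1) (n - 1) ++ lastPow n k ++ desc n (n - 1) (n - 1))
      (desc n (n - 1) (n - 1) ++ lastPow n k ++ desc n (n - 1) (n - 1) ++ lastPow n l) := by
  have base : WordEquiv
      (desc n n n ++ desc n (n - 1) (n - 1) ++ lastPow n k ++ desc n (n - 1) (n - 1))
      (desc n (n - 1) (n - 1) ++ lastPow n k ++ desc n (n - 1) (n - 1) ++ desc n n n) := by
    rw [desc_self (by omega) le_rfl, desc_self (x := n - 1) (by omega) (by omega),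
      lastPow_eq_replicate (by omega)]
    refine WordEquiv.symm (.rel _ _ (.inr ?_))
    simpa using BraidStep.last [] [] (⟨n - 1, by omega⟩ : Fin n) ⟨n - 1 - 1, by omega⟩ k
      (by simp; omega) (by simp; omega)
  induction l with
  | zero => simpa [lastPow] using WordEquiv.refl _
  | succ l ih =>
    have h1 := base.append_left (lastPow n l)
    have h2 := ih.append_right (desc n n n)
    rw [lastPow_succ]
    simp only [List.append_assoc] at *
    exact h1.trans h2

/-- This is the multiplication by `s_x` when the colors at `x` and `x + 1` are both nonzero: the
colors are exchanged and a letter `s_{n-1}` is expelled to the left. The power `s_n^k` first moves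
next to the leading `s_{n-1}`; then `desc_desc` and `lastPow_braid` rearrange the rest. -/
theorem descPow_descPow {x k l : ℕ} (hx : 1 ≤ x) (hxn : x < n) :
    WordEquiv (descPow n l x ++ descPow n k x)
      (desc n (n - 1) (n - 1) ++ (descPow n k x ++ descPow n l (x + 1))) := by
  obtain ⟨m, rfl⟩ : ∃ m, n = m + 2 := ⟨n - 2, by omega⟩
  have hD : ∀ p ∈ desc (m + 2) m x, p.val + 2 < m + 2 := by
    intro p hp
    rw [mem_desc] at hp
    omega
  have h1 : WordEquiv (desc (m + 2) m x ++ lastPow (m + 2) k) (lastPow (m + 2) k ++ desc (m + 2) m x) :=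
    .of_comm (lastPow_comm hD).symm
  have h2 : WordEquiv (lastPow (m + 2) l ++ desc (m + 2) m x) (desc (m + 2) m x ++ lastPow (m + 2) l) :=
    .of_comm (lastPow_comm hD)
  have h3 := desc_desc (n := m + 2) (m := m) hx (by omega) (by omega)
  have h4 := lastPow_braid (n := m + 2) (by omega) k l
  simp only [descPow_eq, show m + 2 - 1 = m + 1 by omega] at *
  have e := desc_cons (n := m + 2) (i := m) (j := x) (by omega)
  have e1 := h1.append_left (lastPow (m + 2) l ++ desc (m + 2) (m + 1) (m + 1))
  have e1 := e1.append_right (desc (m + 2) (m + 1) x)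
  have e2 := h3.append_left (lastPow (m + 2) l ++ desc (m + 2) (m + 1) (m + 1) ++ lastPow (m + 2) k)
  have e3 := h4.append_right (desc (m + 2) m x ++ desc (m + 2) (m + 1) (x + 1))
  have e4 := (h2.append_left (desc (m + 2) (m + 1) (m + 1) ++ lastPow (m + 2) k ++
    desc (m + 2) (m + 1) (m + 1))).append_right (desc (m + 2) (m + 1) (x + 1))
  rw [e] at e1 e2 ⊢
  simp only [List.append_assoc] at *
  exact e1.trans (e2.trans (e3.trans e4))

/-! ### Canonical words -/

/-- The prefix `s_{1 i_1} ⋯ s_{m i_m}`, with the data in the order `[i_m, …, i_1]`. -/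
def prefixWord (n : ℕ) : List ℕ → List (Fin n)
  | [] => []
  | i :: l => prefixWord n l ++ desc n (l.length + 1) i

/-- The condition `1 ≤ i_p ≤ p + 1` for prefix data `[i_m, …, i_1]`. -/
def ValidPrefix : List ℕ → Prop
  | [] => True
  | i :: l => (1 ≤ i ∧ i ≤ l.length + 2) ∧ ValidPrefix l

/-- The block of a suffix at `j`; it is empty if the color is zero. -/
def colorBlock (n j : ℕ) (c : ZMod d) : List (Fin n) :=
  if c = 0 then [] else descPow n c.val j

/-- The suffix with colors `c_j, c_{j+1}, …`. -/
def colorWord (n : ℕ) : ℕ → List (ZMod d) → List (Fin n)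
  | _, [] => []
  | j, c :: cs => colorBlock n j c ++ colorWord n (j + 1) cs

theorem mem_colorWord {j : ℕ} {cs : List (ZMod d)} (h : j + cs.length ≤ n + 1) {p : Fin n}
    (hp : p ∈ colorWord n j cs) : j ≤ p.val + 1 := by
  induction cs generalizing j with
  | nil => simp [colorWord] at hp
  | cons c cs ih =>
    simp only [List.length_cons] at h
    rw [colorWord, List.mem_append, colorBlock] at hp
    rcases hp with hp | hp
    · split_ifs at hp
      · simp at hp
      · exact mem_descPow hp (by omega)
    · have := ih (by omega) hp
      omega

theorem colorWord_comm {j x : ℕ} {cs : List (ZMod d)} (h : j + cs.length ≤ n + 1)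
    (hx : x + 1 < j) :
    CommEquiv (colorWord n j cs ++ desc n x x) (desc n x x ++ colorWord n j cs) := by
  refine CommEquiv.swap fun p hp q hq => ?_
  have := mem_colorWord h hp
  rw [mem_desc] at hq
  omega

/-- Compare `s_x` with the last letter `s_i` of the last block. It extends the block if `x + 1 = i`
and shortens it if `x = i`; otherwise it crosses the block, as `s_x` or as `s_{x-1}`, and acts on
the shorter prefix. -/
theorem prefixWord_letter {l : List ℕ} (hl : ValidPrefix l) {x : ℕ} (hx : 1 ≤ x)
    (hxl : x ≤ l.length) (hn : l.length < n) :
    ∃ l', ValidPrefix l' ∧ l'.length = l.length ∧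
      Reduces d (prefixWord n l ++ desc n x x) (prefixWord n l') := by
  induction l generalizing x with
  | nil => simp at hxl; omega
  | cons i l ih =>
    obtain ⟨⟨hi1, hi2⟩, hv⟩ := hl
    simp only [List.length_cons] at hxl hn
    rw [prefixWord]
    have pass : ∀ y, 1 ≤ y → y ≤ l.length →
        WordEquiv (desc n (l.length + 1) i ++ desc n x x)
          (desc n y y ++ desc n (l.length + 1) i) →
        ∃ l', ValidPrefix l' ∧ l'.length = (i :: l).length ∧
          Reduces d (prefixWord n l ++ desc n (l.length + 1) i ++ desc n x x)
            (prefixWord n l') := by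
      intro y hy1 hy2 hy
      obtain ⟨l', h1, h2, h3⟩ := ih hv hy1 hy2 (by omega)
      refine ⟨i :: l', ⟨⟨hi1, by omega⟩, h1⟩, by simp [h2], ?_⟩
      have e1 : Reduces d _ _ := .of_equiv (hy.append_left (prefixWord n l))
      have e2 := h3.append_right (desc n (l.length + 1) i)
      rw [prefixWord, h2]
      rw [List.append_assoc] at *
      exact e1.trans e2
    rcases lt_trichotomy x i with h | rfl | h
    · by_cases h' : x + 1 = i
      · subst h'
        refine ⟨x :: l, ⟨⟨hx, by omega⟩, hv⟩, by simp, ?_⟩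
        rw [prefixWord, List.append_assoc, ← desc_snoc (by omega)]
        exact .refl _
      · exact pass x hx (by omega) (.of_comm (desc_comm_letter (by omega)))
    · refine ⟨(x + 1) :: l, ⟨⟨by omega, by omega⟩, hv⟩, by simp, ?_⟩
      rw [prefixWord, desc_snoc (j := x) (by omega)]
      have := (Reduces.sq (d := d) (n := n) (x := x) (by omega)).append_left
        (prefixWord n l ++ desc n (l.length + 1) (x + 1))
      simpa using this
    · exact pass (x - 1) (by omega) (by omega) (desc_shift hi1 h (by omega) (by omega))

theorem colorBlock_snoc {j : ℕ} {c : ZMod d} (hj : j < n) (hc : c ≠ 0) :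
    colorBlock n j c = colorBlock n (j + 1) c ++ desc n j j := by
  rw [colorBlock, colorBlock, if_neg hc, if_neg hc, descPow_eq, descPow_eq,
    desc_snoc (j := j) (by omega), List.append_assoc]

/-- Multiplication by `s_x` exchanges the colors at `x` and `x + 1`. If exactly one of them is
nonzero, its block gains or loses the letter `s_x`. If both or neither are nonzero, a letter is
passed on to the left and has to be absorbed by the prefix. -/
theorem colorWord_letter {j : ℕ} {cs : List (ZMod d)} (h : j + cs.length = n + 1) {x : ℕ}
    (hj : 1 ≤ j) (hjx : j ≤ x) (hx : x < n) :
    ∃ cs' : List (ZMod d), cs'.length = cs.length ∧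
      (Reduces d (colorWord n j cs ++ desc n x x) (colorWord n j cs') ∨
        ∃ y, j ≤ y ∧ y < n ∧
          Reduces d (colorWord n j cs ++ desc n x x) (desc n y y ++ colorWord n j cs')) := by
  induction cs generalizing j with
  | nil => simp at h; omega
  | cons c cs ih =>
    simp only [List.length_cons] at h
    rcases hjx.eq_or_lt with rfl | hjx
    · obtain ⟨c', cs, rfl⟩ := List.exists_cons_of_length_pos (l := cs) (by omega)
      simp only [List.length_cons] at h
      have e : Reduces d (colorWord n j (c :: c' :: cs) ++ desc n j j)
          (colorBlock n j c ++ (colorBlock n (j + 1) c' ++ desc n j j) ++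
            colorWord n (j + 1 + 1) cs) := by
        have := (colorWord_comm (n := n) (x := j) (j := j + 1 + 1) (cs := cs) (by omega)
          (by omega)).append_left (colorBlock n j c ++ colorBlock n (j + 1) c')
        refine .of_comm ?_
        simpa [colorWord] using this
      by_cases hc' : c' = 0
      · subst hc'
        by_cases hc : c = 0
        · subst hc
          exact ⟨0 :: 0 :: cs, rfl, .inr ⟨j, le_rfl, hx,
            by simpa [colorWord, colorBlock] using e⟩⟩
        · refine ⟨0 :: c :: cs, rfl, .inl (e.trans ?_)⟩
          have := ((Reduces.sq (d := d) hx).append_left (colorBlock n (j + 1) c)).append_right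
            (colorWord n (j + 1 + 1) cs)
          rw [colorBlock_snoc hx hc]
          simpa [colorWord, colorBlock] using this
      · rw [← colorBlock_snoc hx hc'] at e
        by_cases hc : c = 0
        · subst hc
          refine ⟨c' :: 0 :: cs, rfl, .inl ?_⟩
          simpa [colorWord, colorBlock] using e
        · refine ⟨c' :: c :: cs, rfl, .inr ⟨n - 1, by omega, by omega, e.trans ?_⟩⟩
          have := (descPow_descPow (k := c'.val) (l := c.val) hj hx).append_right
            (colorWord n (j + 1 + 1) cs)
          refine .of_equiv ?_
          simpa [colorWord, colorBlock, hc, hc'] using this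
    · obtain ⟨cs', h1, h2⟩ := ih (j := j + 1) (by omega) (by omega) (by omega)
      refine ⟨c :: cs', by simp [h1], ?_⟩
      rcases h2 with h2 | ⟨y, hy1, hy2, h2⟩
      · left
        have := h2.append_left (colorBlock n j c)
        simpa [colorWord] using this
      · right
        -- A nonempty block lowers the letter by one as it crosses; the letter stays at least `j`
        -- because it was at least `j + 1`.
        by_cases hc : c = 0
        · subst hc
          refine ⟨y, by omega, hy2, ?_⟩
          simpa [colorWord, colorBlock] using h2
        · refine ⟨y - 1, by omega, by omega, ?_⟩
          have e1 := h2.append_left (colorBlock n j c)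
          have e2 : Reduces d _ _ := .of_equiv
            ((descPow_shift (k := c.val) hj (show j < y by omega) hy2).append_right
            (colorWord n (j + 1) cs'))
          simp only [colorWord, colorBlock, hc, if_false, List.append_assoc] at e1 e2 ⊢
          exact e1.trans e2

theorem lastPow_reduces (hd : 2 ≤ d) (hn : 1 ≤ n) (c : ZMod d) :
    Reduces d (colorBlock n n c ++ desc n n n) (colorBlock n n (c + 1)) := by
  have : NeZero d := ⟨by omega⟩
  have : Fact (1 < d) := ⟨hd⟩
  have hlt := ZMod.val_lt c
  have e : desc n (n - 1) n = [] := desc_nil (by omega)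
  have e1 : ∀ c : ZMod d, colorBlock n n c = lastPow n c.val := by
    intro c
    rw [colorBlock, descPow_eq, e]
    split_ifs with h
    · simp [h, lastPow]
    · simp
  rw [e1, e1, ← lastPow_succ]
  -- If the color wraps around to zero, `s_n^d = 1` shortens the word; otherwise the two words
  -- coincide.
  rcases (show c.val + 1 ≤ d by omega).eq_or_lt with h | h
  · have hv : (c + 1).val = 0 := by
      rw [ZMod.val_add, ZMod.val_one, h, Nat.mod_self]
    rw [hv, h, lastPow_eq_replicate hn, lastPow_eq_replicate hn]
    refine ⟨?_, .inr (by simp; omega)⟩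
    rw [eval_replicate, s_pow_last (by simp; omega), eval_replicate, pow_zero]
  · have hv : (c + 1).val = c.val + 1 := by
      rw [ZMod.val_add, ZMod.val_one, Nat.mod_eq_of_lt h]
    rw [hv]
    exact .refl _

theorem colorWord_last (hd : 2 ≤ d) {j : ℕ} {cs : List (ZMod d)} (h : j + cs.length = n + 1)
    (hjn : j ≤ n) (hj : 1 ≤ j) :
    ∃ cs' : List (ZMod d), cs'.length = cs.length ∧
      Reduces d (colorWord n j cs ++ desc n n n) (colorWord n j cs') := by
  induction cs generalizing j with
  | nil => simp at h; omega
  | cons c cs ih =>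
    simp only [List.length_cons] at h
    rcases hjn.eq_or_lt with rfl | hjn
    · have : cs = [] := List.length_eq_zero_iff.1 (by omega)
      subst this
      exact ⟨[c + 1], rfl, by simpa [colorWord] using lastPow_reduces hd hj c⟩
    · obtain ⟨cs', h1, h2⟩ := ih (j := j + 1) (by omega) (by omega) (by omega)
      refine ⟨c :: cs', by simp [h1], ?_⟩
      have := h2.append_left (colorBlock n j c)
      simpa [colorWord] using this

/-- The canonical word with the given prefix and suffix data. -/
def canonicalWord (n : ℕ) (l : List ℕ) (cs : List (ZMod d)) : List (Fin n) :=
  prefixWord n l ++ colorWord n 1 cs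

theorem exists_prefixWord_eq_nil (l : ℕ) :
    ∃ w, ValidPrefix w ∧ w.length = l ∧ prefixWord n w = [] := by
  induction l with
  | zero => exact ⟨[], trivial, rfl, rfl⟩
  | succ l ih =>
    obtain ⟨w, h1, h2, h3⟩ := ih
    refine ⟨(l + 2) :: w, ⟨by omega, h1⟩, by simp [h2], ?_⟩
    rw [prefixWord, h3, h2, desc_nil (by omega), List.append_nil]

theorem colorWord_replicate_zero (j m : ℕ) :
    colorWord n j (List.replicate m (0 : ZMod d)) = [] := by
  induction m generalizing j with
  | zero => rfl
  | succ m ih => simp [List.replicate_succ, colorWord, colorBlock, ih]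

/-- Letters are multiplied on one at a time: the suffix absorbs each of them or hands a letter with
label below `n` to the prefix. As `Reduces` records whether length was lost, this yields both the
existence of normal forms and the connection of reduced words by moves. -/
theorem exists_reduces_canonicalWord (hd : 2 ≤ d) (hn : 1 ≤ n) (u : List (Fin n)) :
    ∃ l, ∃ cs : List (ZMod d), ValidPrefix l ∧ l.length = n - 1 ∧ cs.length = n ∧
      Reduces d u (canonicalWord n l cs) := by
  induction u using List.reverseRecOn with
  | nil =>
    obtain ⟨w, h1, h2, h3⟩ := exists_prefixWord_eq_nil (n := n) (n - 1)
    refine ⟨w, List.replicate n 0, h1, h2, by simp, ?_⟩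
    rw [canonicalWord, h3, colorWord_replicate_zero]
    exact .refl _
  | append_singleton u p ih =>
    obtain ⟨l, cs, h1, h2, h3, h4⟩ := ih
    have hp : [p] = desc n (p.val + 1) (p.val + 1) := by
      rw [desc_self (by omega) (by omega)]; rfl
    rw [hp]
    have e1 := h4.append_right (desc n (p.val + 1) (p.val + 1))
    rw [canonicalWord, List.append_assoc] at e1
    by_cases hpn : p.val + 1 = n
    · rw [hpn] at e1 ⊢
      obtain ⟨cs', h5, h6⟩ := colorWord_last (n := n) hd (j := 1) (cs := cs) (by omega) hn le_rfl
      exact ⟨l, cs', h1, h2, by omega, e1.trans (h6.append_left _)⟩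
    · obtain ⟨cs', h5, h6⟩ := colorWord_letter (n := n) (j := 1) (cs := cs) (by omega)
        (x := p.val + 1) le_rfl (by omega) (by omega)
      rcases h6 with h6 | ⟨y, hy1, hy2, h6⟩
      · exact ⟨l, cs', h1, h2, by omega, e1.trans (h6.append_left _)⟩
      · obtain ⟨l', h7, h8, h9⟩ := prefixWord_letter (d := d) (n := n) h1 hy1 (by omega) (by omega)
        refine ⟨l', cs', h7, by omega, by omega, e1.trans ((h6.append_left _).trans ?_)⟩
        rw [← List.append_assoc]
        exact h9.append_right _

end Rewriting

/-! ### The action on colored points and uniqueness of canonical words -/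

section Action

variable {d n : ℕ}

/-- The permutation adding `1` to the color of the point `n`. -/
def colorShift (d n : ℕ) : Equiv.Perm (ℕ × ZMod d) where
  toFun x := (x.1, if x.1 = n then x.2 + 1 else x.2)
  invFun x := (x.1, if x.1 = n then x.2 - 1 else x.2)
  left_inv x := by ext <;> simp; split_ifs <;> simp
  right_inv x := by ext <;> simp; split_ifs <;> simp

/-- The permutation exchanging the points `x` and `x + 1`. -/
def pointSwap (d x : ℕ) : Equiv.Perm (ℕ × ZMod d) :=
  (Equiv.swap x (x + 1)).prodCongr (Equiv.refl _)

theorem colorShift_apply (q : ℕ) (c : ZMod d) :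
    colorShift d n (q, c) = (q, if q = n then c + 1 else c) := rfl

theorem pointSwap_apply (x q : ℕ) (c : ZMod d) :
    pointSwap d x (q, c) = (if q = x then x + 1 else if q = x + 1 then x else q, c) := by
  simp [pointSwap, Equiv.swap_apply_def]

theorem colorShift_pow_apply (k q : ℕ) (c : ZMod d) :
    (colorShift d n ^ k) (q, c) = (q, if q = n then c + k else c) := by
  induction k with
  | zero => simp
  | succ k ih =>
    rw [pow_succ', Equiv.Perm.mul_apply, ih, colorShift_apply]
    split_ifs <;> simp [add_assoc]

/-- The action of the generators of `G(d,1,n)` on colored points. -/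
def genPerm (d n : ℕ) (p : Fin n) : Equiv.Perm (ℕ × ZMod d) :=
  if p.val + 1 = n then colorShift d n else pointSwap d (p.val + 1)

theorem genPerm_rel : ∀ r ∈ {r : FreeGroup (Fin n) | Rel1 d n r},
    FreeGroup.lift (genPerm d n) r = 1 := by
  intro r hr
  cases hr with
  | pow_last t ht =>
    simp only [map_pow, FreeGroup.lift_apply_of, genPerm, ht, if_true]
    ext ⟨q, c⟩ : 1
    rw [colorShift_pow_apply]
    simp
  | sq i hi =>
    simp only [pow_two, map_mul, FreeGroup.lift_apply_of, genPerm, hi.ne, if_false]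
    ext ⟨q, c⟩ : 1
    simp only [Equiv.Perm.mul_apply, pointSwap_apply, Equiv.Perm.one_apply, Prod.mk.injEq, and_true]
    grind
  | comm i j hij =>
    have := i.isLt
    simp only [map_mul, map_inv, FreeGroup.lift_apply_of, mul_inv_eq_one, genPerm,
      show j.val + 1 ≠ n by omega, if_false]
    ext ⟨q, c⟩ : 1
    split_ifs
    · simp only [Equiv.Perm.mul_apply, pointSwap_apply, colorShift_apply, Prod.mk.injEq]
      grind
    · simp only [Equiv.Perm.mul_apply, pointSwap_apply, Prod.mk.injEq, and_true]
      grind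
  | braid i j hij hj =>
    simp only [map_mul, map_inv, FreeGroup.lift_apply_of, mul_inv_eq_one, genPerm,
      show j.val + 1 ≠ n by omega, show i.val + 1 ≠ n by omega, if_false]
    ext ⟨q, c⟩ : 1
    simp only [Equiv.Perm.mul_apply, pointSwap_apply, Prod.mk.injEq, and_true]
    grind
  | braid_last t a ht ha =>
    simp only [map_mul, map_inv, FreeGroup.lift_apply_of, mul_inv_eq_one, genPerm,
      show a.val + 1 ≠ n by omega, ht, if_false, if_true]
    ext ⟨q, c⟩ : 1
    simp only [Equiv.Perm.mul_apply, pointSwap_apply, colorShift_apply, Prod.mk.injEq]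
    grind

/-- The action of `G(d,1,n)` on colored points. -/
def pointAction (d n : ℕ) : G1 d n →* Equiv.Perm (ℕ × ZMod d) :=
  PresentedGroup.toGroup genPerm_rel

/-- The action of a word on colored points. -/
def wordPerm (d : ℕ) {n : ℕ} (w : List (Fin n)) : Equiv.Perm (ℕ × ZMod d) :=
  pointAction d n (eval d n w)

theorem wordPerm_append (u v : List (Fin n)) (x : ℕ × ZMod d) :
    wordPerm d (u ++ v) x = wordPerm d u (wordPerm d v x) := by
  rw [wordPerm, eval_append, map_mul, Equiv.Perm.mul_apply]; rfl

theorem wordPerm_nil (x : ℕ × ZMod d) : wordPerm d ([] : List (Fin n)) x = x := by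
  simp [wordPerm, eval]

theorem wordPerm_singleton (p : Fin n) : wordPerm d [p] = genPerm d n p := by
  simp [wordPerm, eval, pointAction, s]

theorem wordPerm_letter {x : ℕ} (h1 : 1 ≤ x) (h2 : x < n) (q : ℕ) (c : ZMod d) :
    wordPerm d (desc n x x) (q, c) = (if q = x then x + 1 else if q = x + 1 then x else q, c) := by
  rw [desc_self h1 h2.le, wordPerm_singleton, genPerm, if_neg (by simp; omega), pointSwap_apply]
  simp [Nat.sub_add_cancel h1]

theorem wordPerm_desc {i j : ℕ} (hj : 1 ≤ j) (hji : j ≤ i + 1) (hi : i < n) (q : ℕ) (c : ZMod d) :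
    wordPerm d (desc n i j) (q, c) =
      (if q = j then i + 1 else if j < q ∧ q ≤ i + 1 then q - 1 else q, c) := by
  obtain ⟨i, rfl⟩ | rfl : (∃ i', i = i' + 1) ∨ i = 0 := by
    rcases i with _ | i
    · exact .inr rfl
    · exact .inl ⟨i, rfl⟩
  · induction i, (show j - 2 ≤ i by omega) using Nat.le_induction with
    | base =>
      rcases hji.eq_or_lt with h | h
      · rw [desc_nil (by omega), wordPerm_nil]
        simp only [Prod.mk.injEq, and_true]
        grind
      · have e : j - 2 + 1 = j := by omega
        rw [e, wordPerm_letter hj (by omega)]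
        simp only [Prod.mk.injEq, and_true]
        grind
    | succ i hi' ih =>
      rcases hji.eq_or_lt with h | h
      · rw [desc_nil (by omega), wordPerm_nil]
        simp only [Prod.mk.injEq, and_true]
        grind
      · rw [desc_cons (by omega), wordPerm_append, ih (by omega) (by omega),
          wordPerm_letter (by omega) hi]
        simp only [Prod.mk.injEq, and_true]
        grind
  · have : j = 1 := by omega
    subst this
    rw [desc_nil (by omega), wordPerm_nil]
    simp only [Prod.mk.injEq, and_true]
    grind

theorem wordPerm_lastPow (hn : 1 ≤ n) (k q : ℕ) (c : ZMod d) :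
    wordPerm d (lastPow n k) (q, c) = (q, if q = n then c + k else c) := by
  rw [lastPow_eq_replicate hn, ← colorShift_pow_apply (n := n), wordPerm, eval_replicate, map_pow]
  congr 2
  have := wordPerm_singleton (d := d) (⟨n - 1, by omega⟩ : Fin n)
  rw [genPerm, if_pos (by simp; omega)] at this
  rw [← this, wordPerm]
  simp [eval]

theorem wordPerm_descPow {j k : ℕ} (hj : 1 ≤ j) (hjn : j ≤ n) (q : ℕ) (c : ZMod d) :
    wordPerm d (descPow n k j) (q, c) =
      if q = j then (n, c + k) else (if j < q ∧ q ≤ n then q - 1 else q, c) := by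
  rw [descPow_eq, wordPerm_append, wordPerm_desc hj (by omega) (by omega),
    wordPerm_lastPow (by omega)]
  split_ifs <;> simp <;> omega

/-- A nonempty block at `j` sends `j` to `n` and adds its color, while the points above `j` up to
`n` move down by one with their color unchanged. Blocks act from right to left, so the point `q`
picks up only the color at `q`. -/
theorem wordPerm_colorWord [NeZero d] {j : ℕ} {cs : List (ZMod d)} (hj : 1 ≤ j)
    (h : j + cs.length = n + 1) {q : ℕ} (hq : 1 ≤ q) (hqn : q ≤ n) (c : ZMod d) :
    (q < j → wordPerm d (colorWord n j cs) (q, c) = (q, c)) ∧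
    (j ≤ q → ∃ q', j ≤ q' ∧ q' ≤ n ∧
      wordPerm d (colorWord n j cs) (q, c) = (q', c + cs.getD (q - j) 0)) := by
  induction cs generalizing j with
  | nil =>
    simp only [List.length_nil] at h
    exact ⟨fun _ => wordPerm_nil _, fun _ => by omega⟩
  | cons a cs ih =>
    simp only [List.length_cons] at h
    have ih := ih (j := j + 1) (by omega) (by omega)
    have hb : ∀ q' c', wordPerm d (colorBlock n j a) (q', c') =
        if a = 0 then (q', c') else
          if q' = j then (n, c' + a) else (if j < q' ∧ q' ≤ n then q' - 1 else q', c') := by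
      intro q' c'
      rw [colorBlock]
      split_ifs with h1
      · exact wordPerm_nil _
      all_goals
        rw [wordPerm_descPow hj (by omega), ZMod.natCast_zmod_val]
        simp [*]
    refine ⟨fun hqj => ?_, fun hqj => ?_⟩
    · rw [colorWord, wordPerm_append, ih.1 (by omega), hb]
      split_ifs <;> simp <;> omega
    · rcases hqj.eq_or_lt with rfl | hqj
      · rw [colorWord, wordPerm_append, ih.1 (by omega), hb]
        by_cases ha : a = 0
        · exact ⟨j, le_rfl, hqn, by simp [ha]⟩
        · exact ⟨n, hqn, le_rfl, by simp [ha]⟩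
      · obtain ⟨q', h1, h2, h3⟩ := ih.2 hqj
        rw [colorWord, wordPerm_append, h3, hb]
        have e : (a :: cs).getD (q - j) 0 = cs.getD (q - (j + 1)) 0 := by
          rw [show q - j = (q - (j + 1)) + 1 by omega]
          simp
        rw [e]
        by_cases ha : a = 0
        · exact ⟨q', by omega, h2, by simp [ha]⟩
        · refine ⟨q' - 1, by omega, by omega, ?_⟩
          rw [if_neg ha, if_neg (by omega), if_pos ⟨by omega, h2⟩]

theorem wordPerm_snd {w : List (Fin n)} (hw : ∀ p ∈ w, p.val + 1 < n) (x : ℕ × ZMod d) :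
    (wordPerm d w x).2 = x.2 := by
  induction w with
  | nil => rw [wordPerm_nil]
  | cons p w ih =>
    have := wordPerm_append [p] w x
    rw [List.singleton_append] at this
    rw [this, wordPerm_singleton, genPerm, if_neg (hw p List.mem_cons_self).ne, ← ih fun q hq =>
      hw q (List.mem_cons_of_mem _ hq)]
    rfl

theorem mem_prefixWord {l : List ℕ} {p : Fin n} (h : p ∈ prefixWord n l) :
    p.val + 1 ≤ l.length := by
  induction l with
  | nil => simp [prefixWord] at h
  | cons i l ih =>
    rw [prefixWord, List.mem_append, mem_desc] at h
    simp only [List.length_cons]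
    rcases h with h | h
    · have := ih h; omega
    · omega

theorem wordPerm_prefixWord {l : List ℕ} (hl : ValidPrefix l) (hn : l.length < n) {q : ℕ}
    (hq : l.length + 1 < q) (c : ZMod d) : wordPerm d (prefixWord n l) (q, c) = (q, c) := by
  induction l with
  | nil => exact wordPerm_nil _
  | cons i l ih =>
    obtain ⟨⟨h1, h2⟩, h3⟩ := hl
    simp only [List.length_cons] at hn hq
    rw [prefixWord, wordPerm_append, wordPerm_desc h1 (by omega) (by omega), if_neg (by omega),
      if_neg (by omega)]
    exact ih h3 (by omega) (by omega)

/-- The last block `s_{m i}` sends `i` to `m + 1`, which the earlier blocks fix. So `i` is the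
preimage of `m + 1`; the block is then cancelled. -/
theorem prefixWord_injective {l l' : List ℕ} (hl : ValidPrefix l) (hl' : ValidPrefix l')
    (hlen : l.length = l'.length) (hn : l.length < n)
    (h : eval d n (prefixWord n l) = eval d n (prefixWord n l')) : l = l' := by
  induction l generalizing l' with
  | nil => exact (List.length_eq_zero_iff.1 hlen.symm).symm
  | cons i l ih =>
    obtain ⟨i', l', rfl⟩ := List.exists_cons_of_length_pos (l := l') (by rw [← hlen]; simp)
    have key : ∀ (i : ℕ) (l : List ℕ), ValidPrefix (i :: l) → l.length + 1 < n →
        wordPerm d (prefixWord n (i :: l)) (i, 0) = (l.length + 2, 0) := by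
      rintro i l ⟨⟨h1, h2⟩, h3⟩ hn
      rw [prefixWord, wordPerm_append, wordPerm_desc h1 (by omega) (by omega), if_pos rfl]
      exact wordPerm_prefixWord h3 (by omega) (by omega) 0
    simp only [List.length_cons, Nat.add_right_cancel_iff] at hlen hn
    have hi : i = i' := by
      have e1 := key i l hl hn
      have e2 := key i' l' hl' (by omega)
      rw [wordPerm, h] at e1
      rw [← hlen, ← e1, wordPerm] at e2
      exact (Prod.ext_iff.1 ((pointAction d n _).injective e2)).1.symm
    subst hi
    rw [prefixWord, prefixWord, eval_append, eval_append, ← hlen, mul_left_inj] at h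
    rw [ih hl.2 hl'.2 hlen (by omega) h]

/-- A prefix preserves colors, so the colors of the suffix are read off from the images of the
points of color zero. Cancelling the suffix leaves the prefix. -/
theorem canonicalWord_injective [NeZero d] (hn : 1 ≤ n) {l l' : List ℕ} {cs cs' : List (ZMod d)}
    (hl : ValidPrefix l) (hl' : ValidPrefix l') (h1 : l.length = n - 1) (h1' : l'.length = n - 1)
    (h2 : cs.length = n) (h2' : cs'.length = n)
    (h : eval d n (canonicalWord n l cs) = eval d n (canonicalWord n l' cs')) :
    l = l' ∧ cs = cs' := by
  have key : ∀ (l : List ℕ) (cs : List (ZMod d)), l.length = n - 1 → cs.length = n →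
      ∀ q, q < n → (wordPerm d (canonicalWord n l cs) (q + 1, 0)).2 = cs.getD q 0 := by
    intro l cs h1 h2 q hq
    obtain ⟨q', _, _, h⟩ := (wordPerm_colorWord (d := d) (n := n) (j := 1) (cs := cs) le_rfl
      (by omega) (q := q + 1) (by omega) (by omega) 0).2 (by omega)
    rw [canonicalWord, wordPerm_append, h, wordPerm_snd]
    · simp
    · intro p hp
      have := mem_prefixWord hp
      omega
  have hcs : cs = cs' := by
    refine List.ext_getElem (by omega) fun q hq hq' => ?_
    have e1 := key l cs h1 h2 q (by omega)
    have e2 := key l' cs' h1' h2' q (by omega)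
    rw [wordPerm, h] at e1
    rw [wordPerm, e1] at e2
    simpa [hq, hq'] using e2
  subst hcs
  refine ⟨prefixWord_injective (d := d) (n := n) hl hl' (by omega) (by omega) ?_, rfl⟩
  rw [canonicalWord, canonicalWord, eval_append, eval_append, mul_left_inj] at h
  exact h

/-- A reduced word cannot lose length, so its reduction to a canonical word consists of moves only;
uniqueness identifies the canonical word reached. -/
theorem canonicalWord_mem_reducedWords (hd : 2 ≤ d) (hn : 1 ≤ n) {l : List ℕ}
    {cs : List (ZMod d)} (hl : ValidPrefix l) (h1 : l.length = n - 1) (h2 : cs.length = n)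
    {v : List (Fin n)} (hv : v ∈ reducedWords d n (eval d n (canonicalWord n l cs))) :
    WordEquiv v (canonicalWord n l cs) := by
  have : NeZero d := ⟨by omega⟩
  obtain ⟨l', cs', hl', h1', h2', hr⟩ := exists_reduces_canonicalWord (d := d) hd hn v
  obtain ⟨rfl, rfl⟩ := canonicalWord_injective hn hl' hl h1' h1 h2' h2 (hr.1.symm.trans hv.1)
  rcases hr.2 with h | h
  · exact h
  · exact absurd (hv.2 _ rfl) (by omega)

theorem canonicalWord_reduced (hd : 2 ≤ d) (hn : 1 ≤ n) {l : List ℕ}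
    {cs : List (ZMod d)} (hl : ValidPrefix l) (h1 : l.length = n - 1) (h2 : cs.length = n) :
    canonicalWord n l cs ∈ reducedWords d n (eval d n (canonicalWord n l cs)) := by
  have : NeZero d := ⟨by omega⟩
  refine ⟨rfl, fun v hv => ?_⟩
  obtain ⟨l', cs', hl', h1', h2', hr⟩ := exists_reduces_canonicalWord (d := d) hd hn v
  obtain ⟨rfl, rfl⟩ := canonicalWord_injective hn hl' hl h1' h1 h2' h2 (hr.1.symm.trans hv)
  rcases hr.2 with h | h
  · exact h.length_eq.ge
  · exact h.le

end Action

/-! ### Full commutativity of canonical words -/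

section FullCommutativity

variable {d n : ℕ}

theorem commStep_filter {P : Fin n → Bool}
    (hP : ∀ p q : Fin n, P p → P q → p.val ≤ q.val + 1) {u v : List (Fin n)} (h : CommStep u v) :
    u.filter P = v.filter P := by
  obtain ⟨u, v, i, j, hij⟩ := h
  simp only [List.filter_append]
  congr 2
  by_cases hi : P i
  · have hj : ¬ P j := fun hj => by have := hP i j hi hj; omega
    simp [hi, hj]
  · simp [List.filter_cons, hi]

theorem commEquiv_filter {P : Fin n → Bool}
    (hP : ∀ p q : Fin n, P p → P q → p.val ≤ q.val + 1) {u v : List (Fin n)}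
    (h : CommEquiv u v) : u.filter P = v.filter P := by
  induction h with
  | rel u v h => exact commStep_filter hP h
  | refl u => rfl
  | symm u v _ ih => exact ih.symm
  | trans u v w _ _ ih1 ih2 => exact ih1.trans ih2

theorem BraidStep.not_commEquiv {u v : List (Fin n)} (h : BraidStep u v) : ¬ CommEquiv u v := by
  intro hc
  cases h with
  | braid u v i j hij hj =>
    have h1 := hc.perm
    rw [List.perm_append_right_iff, List.perm_append_left_iff] at h1
    have h2 := h1.count_eq i
    have hne : i ≠ j := fun h => by rw [h] at hij; omega
    simp [hne.symm] at h2
  | last u v t a k ht ha =>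
    -- Both sides have the same letters here, but commutations preserve the order among the letters
    -- `s_{n-1}` and `s_n`, and the two sides begin differently.
    have h1 := commEquiv_filter (P := fun p : Fin n => decide (n ≤ p.val + 2))
      (fun p q hp hq => by simp at hp hq; omega) hc
    have h2 : (decide (n ≤ a.val + 2)) = true := by simp; omega
    have h3 : (decide (n ≤ t.val + 2)) = true := by simp; omega
    simp only [List.filter_append, List.append_assoc, List.append_cancel_left_eq] at h1
    simp [h2, h3] at h1
    have := h1.1
    rw [this] at ha
    omega

/-- The letters of `w` that are equal to `i` or `i - 1`. -/
def lowerPart (i : ℕ) (w : List (Fin n)) : List (Fin n) :=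
  w.filter fun p => p.val = i ∨ p.val + 1 = i

/-- The letters of `w` that are equal to `i` or `i + 1`. -/
def upperPart (i : ℕ) (w : List (Fin n)) : List (Fin n) :=
  w.filter fun p => p.val = i ∨ p.val = i + 1

/-- `w` has no two consecutive letters `i`. -/
def NoRepeat (i : ℕ) (w : List (Fin n)) : Prop := w.IsChain fun a b => ¬ (a.val = i ∧ b.val = i)

/-- Between any two occurrences of a letter `i` other than the last one, both `i - 1` and `i + 1`
occur. -/
def Separated (w : List (Fin n)) : Prop :=
  ∀ i, i + 1 < n → NoRepeat i (lowerPart i w) ∧ NoRepeat i (upperPart i w)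

theorem Separated.of_commEquiv {u v : List (Fin n)} (h : CommEquiv u v) (hu : Separated u) :
    Separated v := by
  intro i hi
  rw [lowerPart, upperPart, ← commEquiv_filter (fun p q hp hq => by simp at hp hq; omega) h,
    ← commEquiv_filter (fun p q hp hq => by simp at hp hq; omega) h]
  exact hu i hi

theorem not_noRepeat {i : ℕ} {p : Fin n} (hp : p.val = i) (u v : List (Fin n)) :
    ¬ NoRepeat i (u ++ [p, p] ++ v) := by
  intro h
  have h1 := (List.isChain_append.1 (List.isChain_append.1 h).1).2.1
  simp [hp] at h1

/-- Between the outer letters of `s_i s_{i+1} s_i` there is no `s_{i-1}`, and between those of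
`s_{i+1} s_i s_{i+1}` no `s_{i+2}`. On both sides of the move with `s_n` there is no `s_{n-2}`
between the two letters `s_{n-1}`. -/
theorem BraidStep.not_separated {u v : List (Fin n)} (h : BraidStep u v) :
    ¬ Separated u ∧ ¬ Separated v := by
  cases h with
  | braid u v i j hij hj =>
    constructor
    · intro h
      have := (h i.val (by omega)).1
      simp only [lowerPart, List.filter_append] at this
      have h1 : j.val ≠ i.val := by omega
      have h2 : j.val + 1 ≠ i.val := by omega
      have e : [i, j, i].filter (fun p => decide (p.val = i.val ∨ p.val + 1 = i.val)) = [i, i] := by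
        simp [h1, h2]
      rw [e] at this
      exact not_noRepeat rfl _ _ this
    · intro h
      have := (h j.val hj).2
      simp only [upperPart, List.filter_append] at this
      have h1 : i.val ≠ j.val := by omega
      have h2 : i.val ≠ j.val + 1 := by omega
      have e : [j, i, j].filter (fun p => decide (p.val = j.val ∨ p.val = j.val + 1)) = [j, j] := by
        simp [h1, h2]
      rw [e] at this
      exact not_noRepeat rfl _ _ this
  | last u v t a k ht ha =>
    have h1 : t.val ≠ a.val := by omega
    have h2 : t.val + 1 ≠ a.val := by omega
    constructor
    · intro h
      have := (h a.val (by omega)).1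
      simp only [lowerPart, List.filter_append] at this
      have e : ([a] ++ List.replicate k t ++ [a, t]).filter
          (fun p => decide (p.val = a.val ∨ p.val + 1 = a.val)) = [a, a] := by
        simp [h1, h2]
      rw [← List.filter_append, ← List.filter_append, e] at this
      exact not_noRepeat rfl _ _ this
    · intro h
      have := (h a.val (by omega)).1
      simp only [lowerPart, List.filter_append] at this
      have e : ([t, a] ++ List.replicate k t ++ [a]).filter
          (fun p => decide (p.val = a.val ∨ p.val + 1 = a.val)) = [a, a] := by
        simp [h1, h2]
      rw [← List.filter_append, ← List.filter_append, e] at this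
      exact not_noRepeat rfl _ _ this

/-- Separation is invariant under commutations and fails at both ends of a braid step, so a chain of
moves from a separated word contains no braid step. The equivalence is proved alongside because the
symmetric and transitive cases need it. -/
theorem Separated.commEquiv_of_wordEquiv {u v : List (Fin n)} (h : WordEquiv u v) :
    (Separated u → CommEquiv u v) ∧ (Separated u ↔ Separated v) := by
  induction h with
  | rel u v h =>
    rcases h with h | h
    · have h : CommEquiv u v := .rel _ _ h
      exact ⟨fun _ => h, ⟨of_commEquiv h, of_commEquiv h.symm⟩⟩
    · have := h.not_separated
      exact ⟨fun h' => absurd h' this.1, by simp [this.1, this.2]⟩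
  | refl u => exact ⟨fun _ => .refl u, Iff.rfl⟩
  | symm u v _ ih => exact ⟨fun h => (ih.1 (ih.2.2 h)).symm, ih.2.symm⟩
  | trans u v w _ _ ih1 ih2 =>
    exact ⟨fun h => (ih1.1 h).trans (ih2.1 (ih1.2.1 h)), ih1.2.trans ih2.2⟩

/-- The state of a word built from blocks `s_{m i}` with increasing `m` and `i` from right to
left: its letters (with labels starting from `1`) are larger than `κ`, and a letter smaller than
`M` is preceded by its successor. -/
structure Stacked (κ M : ℕ) (w : List (Fin n)) : Prop where
  lt_letter : ∀ p ∈ w, κ < p.val + 1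
  separated : Separated w
  top : ∀ i, i + 1 < M → i + 1 < n → ∀ p ∈ (upperPart i w).head?, p.val ≠ i

theorem Stacked.nil (κ M : ℕ) : Stacked κ M ([] : List (Fin n)) where
  lt_letter := by simp
  separated := fun i _ => by simp [lowerPart, upperPart, NoRepeat]
  top := by simp [upperPart]

theorem lowerPart_cons (i : ℕ) (p : Fin n) (w : List (Fin n)) :
    lowerPart i (p :: w) =
      if p.val = i ∨ p.val + 1 = i then p :: lowerPart i w else lowerPart i w := by
  simp [lowerPart, List.filter_cons]

theorem upperPart_cons (i : ℕ) (p : Fin n) (w : List (Fin n)) :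
    upperPart i (p :: w) =
      if p.val = i ∨ p.val = i + 1 then p :: upperPart i w else upperPart i w := by
  simp [upperPart, List.filter_cons]

theorem noRepeat_cons {i : ℕ} {p : Fin n} {w : List (Fin n)} :
    NoRepeat i (p :: w) ↔ (∀ q ∈ w.head?, ¬ (p.val = i ∧ q.val = i)) ∧ NoRepeat i w :=
  List.isChain_cons

/-- The block is added letter by letter from its right end. Each new letter has its predecessor
directly behind it, or lies below all of `w`; and any earlier occurrence of it in `w` is shielded by
its successor, by the field `top`. -/
theorem Stacked.desc_append {κ M i m : ℕ} {w : List (Fin n)} (h : Stacked κ M w) (hi : 1 ≤ i)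
    (hiκ : i ≤ κ) (him : i ≤ m + 1) (hm : m < M) (hmn : m < n) :
    Stacked (i - 1) m (desc n m i ++ w) := by
  -- The third condition exempts `j + 1 = y`: that letter has just been put in front and gets its
  -- successor only at the next step. For `y < i` nothing has been added yet, so no exemption is
  -- needed.
  have key : ∀ y, i - 1 ≤ y → y ≤ m →
      Separated (desc n y i ++ w) ∧
      (∀ q ∈ (lowerPart y (desc n y i ++ w)).head?, q.val ≠ y) ∧
      (∀ j, j + 1 < M → j + 1 < n → (j + 1 ≠ y ∨ y < i) →
        ∀ q ∈ (upperPart j (desc n y i ++ w)).head?, q.val ≠ j) := by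
    intro y hy
    induction y, hy using Nat.le_induction with
    | base =>
      intro _
      rw [desc_nil (by omega), List.nil_append]
      refine ⟨h.separated, fun q hq => ?_, fun j hj hjn _ => h.top j hj hjn⟩
      have := h.lt_letter q (List.mem_of_mem_filter (List.mem_of_mem_head? hq))
      omega
    | succ y hy ih =>
      intro hym
      obtain ⟨ih1, ih2, ih3⟩ := ih (by omega)
      have e : desc n (y + 1) i ++ w = (⟨y, by omega⟩ : Fin n) :: (desc n y i ++ w) := by
        rw [desc_cons (by omega), desc_self (by omega) (by omega)]
        rfl
      rw [e]
      refine ⟨fun j hj => ⟨?_, ?_⟩, fun q hq => ?_, fun j hj hjn hjy q hq => ?_⟩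
      · rw [lowerPart_cons]
        split_ifs with h1
        · rw [noRepeat_cons]
          refine ⟨fun q hq hqj => ?_, (ih1 j hj).1⟩
          obtain ⟨rfl, h2⟩ := hqj
          exact ih2 q hq h2
        · exact (ih1 j hj).1
      · rw [upperPart_cons]
        split_ifs with h1
        · rw [noRepeat_cons]
          refine ⟨fun q hq hqj => ?_, (ih1 j hj).2⟩
          obtain ⟨rfl, h2⟩ := hqj
          exact ih3 y (by omega) hj (.inl (by omega)) q hq h2
        · exact (ih1 j hj).2
      · rw [lowerPart_cons, if_pos (by simp)] at hq
        simp only [List.head?_cons, Option.mem_def, Option.some.injEq] at hq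
        subst hq
        simp
      · rw [upperPart_cons] at hq
        split_ifs at hq with h1
        · simp only [List.head?_cons, Option.mem_def, Option.some.injEq] at hq
          subst hq
          simp only at h1 ⊢
          omega
        · simp only at h1
          exact ih3 j hj hjn (by omega) q hq
  obtain ⟨h1, -, h3⟩ := key m (by omega) le_rfl
  refine ⟨fun p hp => ?_, h1, fun j hj hjn => h3 j (by omega) hjn (by omega)⟩
  rw [List.mem_append, mem_desc] at hp
  rcases hp with hp | hp
  · omega
  · have := h.lt_letter p hp
    omega

theorem Stacked.last_append {κ M : ℕ} {w : List (Fin n)} (h : Stacked κ M w) (hκ : κ < n)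
    (hM : n ≤ M + 1) : Stacked κ n (desc n n n ++ w) := by
  rw [desc_self (by omega) le_rfl, List.singleton_append]
  refine ⟨fun p hp => ?_, fun i hi => ⟨?_, ?_⟩, fun i hi _ q hq => ?_⟩
  · rcases List.mem_cons.1 hp with rfl | hp
    · simp; omega
    · exact h.lt_letter p hp
  · rw [lowerPart_cons, if_neg (by simp; omega)]
    exact (h.separated i hi).1
  · rw [upperPart_cons]
    split_ifs
    · rw [noRepeat_cons]
      refine ⟨fun q hq hqj => ?_, (h.separated i hi).2⟩
      have := hqj.1
      simp only at this
      omega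
    · exact (h.separated i hi).2
  · rw [upperPart_cons] at hq
    split_ifs at hq with h1
    · simp only [List.head?_cons, Option.mem_def, Option.some.injEq] at hq
      subst hq
      simp only
      omega
    · simp only at h1
      exact h.top i (by omega) hi q hq

theorem Stacked.lastPow_append {κ M : ℕ} {w : List (Fin n)} (h : Stacked κ M w) (hκ : κ < n)
    (hM : n ≤ M + 1) (k : ℕ) : Stacked κ n (lastPow n (k + 1) ++ w) := by
  have e : ∀ k, lastPow n (k + 1) = desc n n n ++ lastPow n k := by
    intro k; simp [lastPow, List.replicate_succ]
  induction k with
  | zero => rw [e]; simpa [lastPow] using h.last_append hκ hM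
  | succ k ih => rw [e, List.append_assoc]; exact ih.last_append hκ (by omega)

/-- One less than the position of the first nonzero color. -/
def firstColor : ℕ → List (ZMod d) → ℕ
  | j, [] => j - 1
  | j, c :: cs => if c = 0 then firstColor (j + 1) cs else j - 1

theorem le_firstColor (j : ℕ) (cs : List (ZMod d)) : j - 1 ≤ firstColor j cs := by
  induction cs generalizing j with
  | nil => rfl
  | cons c cs ih =>
    rw [firstColor]
    split_ifs
    · have := ih (j + 1); omega
    · rfl

theorem stacked_colorWord [NeZero d] {j : ℕ} {cs : List (ZMod d)} (hj : 1 ≤ j)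
    (h : j + cs.length = n + 1) : Stacked (firstColor j cs) n (colorWord n j cs) := by
  induction cs generalizing j with
  | nil => exact .nil _ _
  | cons c cs ih =>
    simp only [List.length_cons] at h
    have ih := ih (j := j + 1) (by omega) (by omega)
    rw [firstColor, colorWord, colorBlock]
    split_ifs with hc
    · exact ih
    · have h1 := le_firstColor (j + 1) cs
      have h2 := ih.desc_append (i := j) (m := n - 1) hj (by omega) (by omega) (by omega) (by omega)
      obtain ⟨k, hk⟩ : ∃ k, c.val = k + 1 :=
        Nat.exists_eq_add_one.2 (Nat.pos_of_ne_zero fun h => hc ((ZMod.val_eq_zero c).1 h))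
      rw [descPow_eq, List.append_assoc, hk]
      exact h2.lastPow_append (by omega) (by omega) k

/-- The nonempty blocks `s_{m i}` of the prefix have strictly increasing `i ≤ κ`. -/
def AllowedPrefix : ℕ → List ℕ → Prop
  | _, [] => True
  | κ, i :: l => (i = l.length + 2 ∧ AllowedPrefix κ l) ∨
      ((1 ≤ i ∧ i ≤ κ ∧ i ≤ l.length + 1) ∧ AllowedPrefix (i - 1) l)

theorem AllowedPrefix.valid {κ : ℕ} {l : List ℕ} (h : AllowedPrefix κ l) : ValidPrefix l := by
  induction l generalizing κ with
  | nil => trivial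
  | cons i l ih =>
    rcases h with ⟨rfl, h⟩ | ⟨h1, h⟩
    · exact ⟨⟨by omega, le_rfl⟩, ih h⟩
    · exact ⟨⟨by omega, by omega⟩, ih h⟩

theorem Stacked.separated_prefix {κ M : ℕ} {l : List ℕ} {w : List (Fin n)} (h : Stacked κ M w)
    (hl : AllowedPrefix κ l) (hM : l.length < M) (hn : l.length < n) :
    Separated (prefixWord n l ++ w) := by
  induction l generalizing κ M w with
  | nil => exact h.separated
  | cons i l ih =>
    simp only [List.length_cons] at hM hn
    rw [prefixWord, List.append_assoc]
    rcases hl with ⟨rfl, hl⟩ | ⟨⟨h1, h2, h3⟩, hl⟩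
    · rw [desc_nil (by omega), List.nil_append]
      exact ih h hl (by omega) (by omega)
    · exact ih (h.desc_append h1 h2 (by omega) hM hn) hl (by omega) (by omega)

/-! ### The criterion for full commutativity in terms of prefix and colors -/

theorem mem_reducedWords_of_commEquiv {g : G1 d n} {u v : List (Fin n)} (h : CommEquiv u v)
    (hu : u ∈ reducedWords d n g) : v ∈ reducedWords d n g :=
  ⟨(WordEquiv.of_comm h).eval_eq.symm.trans hu.1,
    fun w hw => (WordEquiv.of_comm h).length_eq.symm.le.trans (hu.2 w hw)⟩

theorem fullyCommutative_canonicalWord (hd : 2 ≤ d) (hn : 1 ≤ n) {l : List ℕ}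
    {cs : List (ZMod d)} (h1 : l.length = n - 1) (h2 : cs.length = n)
    (h : AllowedPrefix (firstColor 1 cs) l) :
    FullyCommutative d n (eval d n (canonicalWord n l cs)) := by
  have : NeZero d := ⟨by omega⟩
  have hsep : Separated (canonicalWord n l cs) :=
    (stacked_colorWord (d := d) (n := n) (j := 1) (cs := cs) le_rfl (by omega)).separated_prefix
      h (by omega) (by omega)
  refine ⟨canonicalWord n l cs, Set.ext fun v => ⟨fun hv => ?_, fun hv => ?_⟩⟩
  · exact (Separated.commEquiv_of_wordEquiv
      (canonicalWord_mem_reducedWords hd hn h.valid h1 h2 hv).symm).1 hsep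
  · exact mem_reducedWords_of_commEquiv hv (canonicalWord_reduced hd hn h.valid h1 h2)

/-- Some word in the commutativity class of `w` admits a braid move. -/
def HasBraid (w : List (Fin n)) : Prop := ∃ x y, CommEquiv w x ∧ BraidStep x y

theorem HasBraid.context {w : List (Fin n)} (h : HasBraid w) (u v : List (Fin n)) :
    HasBraid (u ++ w ++ v) := by
  obtain ⟨x, y, h1, h2⟩ := h
  exact ⟨_, _, h1.context u v, h2.context u v⟩

theorem HasBraid.of_commEquiv {w w' : List (Fin n)} (h : HasBraid w) (h' : CommEquiv w' w) :
    HasBraid w' := by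
  obtain ⟨x, y, h1, h2⟩ := h
  exact ⟨_, _, h'.trans h1, h2⟩

/-- A braid step preserves length and value, so both of its ends are reduced words, yet they lie in
different commutativity classes. -/
theorem HasBraid.not_fullyCommutative {w : List (Fin n)} (h : HasBraid w)
    (hw : w ∈ reducedWords d n (eval d n w)) : ¬ FullyCommutative d n (eval d n w) := by
  rintro ⟨w₀, h₀⟩
  obtain ⟨x, y, h1, h2⟩ := h
  have hx := mem_reducedWords_of_commEquiv h1 hw
  have hy : y ∈ reducedWords d n (eval d n w) :=
    ⟨(eval_braidStep h2).symm.trans hx.1, fun v hv => h2.length_eq.symm.le.trans (hx.2 v hv)⟩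
  rw [h₀] at hx hy
  exact h2.not_commEquiv (CommEquiv.trans (CommEquiv.symm hx) hy)

/-- The last letter `s_i` of the left block commutes past everything up to `s_{i+1} s_i` in the
right block and forms `s_i s_{i+1} s_i`. The power of `s_n` lets this serve for suffix blocks as
well as, with `k = 0`, for prefix blocks. -/
theorem hasBraid_desc {i m i' m' k : ℕ} (hi' : i' ≤ i) (hi : 1 ≤ i) (him : i ≤ m) (him' : i < m')
    (hm' : m' < n) : HasBraid (desc n m i ++ (lastPow n k ++ desc n m' i')) := by
  have e1 : desc n m' i' = desc n m' (i + 1 + 1) ++ desc n (i + 1) (i + 1) ++ desc n i i ++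
      desc n (i - 1) i' := by
    rw [desc_split (i := m') (j := i') (m := i + 1) (by omega) (by omega),
      desc_split (i := i + 1) (j := i') (m := i) (by omega) (by omega),
      desc_split (i := i) (j := i') (m := i - 1) (by omega) (by omega),
      Nat.sub_add_cancel hi]
    simp only [List.append_assoc]
  have h1 : CommEquiv (desc n i i ++ (lastPow n k ++ desc n m' (i + 1 + 1)))
      ((lastPow n k ++ desc n m' (i + 1 + 1)) ++ desc n i i) := by
    refine CommEquiv.swap fun p hp q hq => ?_
    rw [mem_desc] at hp
    rw [List.mem_append, mem_desc] at hq
    rcases hq with hq | hq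
    · have := mem_lastPow hq; omega
    · omega
  have h2 : HasBraid (desc n i i ++ desc n (i + 1) (i + 1) ++ desc n i i) := by
    rw [desc_self hi (by omega), desc_self (x := i + 1) (by omega) (by omega)]
    have hb := BraidStep.braid [] [] (⟨i - 1, by omega⟩ : Fin n) ⟨i + 1 - 1, by omega⟩
      (by simp; omega) (by simp; omega)
    simp only [List.nil_append, List.append_nil] at hb
    exact ⟨_, _, .refl _, hb⟩
  have h3 := h2.context (desc n m (i + 1) ++ (lastPow n k ++ desc n m' (i + 1 + 1)))
    (desc n (i - 1) i')
  refine h3.of_commEquiv ?_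
  rw [desc_snoc him, e1]
  have := h1.context (desc n m (i + 1)) (desc n (i + 1) (i + 1) ++ desc n i i ++ desc n (i - 1) i')
  simpa only [List.append_assoc] using this

/-- The `s_n` after the block commutes left past `s_{n-2}, …, s_j` and completes `s_{n-1} s_n^k
s_{n-1} s_n`. -/
theorem hasBraid_last {j k : ℕ} (hn : 2 ≤ n) (hj : j < n) (w : List (Fin n)) :
    HasBraid (desc n (n - 1) (n - 1) ++ (descPow n k j ++ (desc n n n ++ w))) := by
  obtain ⟨m, rfl⟩ : ∃ m, n = m + 2 := ⟨n - 2, by omega⟩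
  simp only [descPow_eq, show m + 2 - 1 = m + 1 by omega]
  rw [desc_cons (i := m) (j := j) (by omega)]
  have h1 : CommEquiv (desc (m + 2) m j ++ desc (m + 2) (m + 2) (m + 2))
      (desc (m + 2) (m + 2) (m + 2) ++ desc (m + 2) m j) := desc_comm_letter (by omega)
  have h2 : HasBraid (desc (m + 2) (m + 1) (m + 1) ++ lastPow (m + 2) k ++
      (desc (m + 2) (m + 1) (m + 1) ++ desc (m + 2) (m + 2) (m + 2))) := by
    rw [desc_self (by omega) le_rfl, desc_self (x := m + 1) (by omega) (by omega),
      lastPow_eq_replicate (by omega)]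
    have hb := BraidStep.last [] [] (⟨m + 2 - 1, by omega⟩ : Fin (m + 2)) ⟨m + 1 - 1, by omega⟩ k
      (by simp) (by simp)
    simp only [List.nil_append, List.append_nil] at hb
    exact ⟨_, _, .refl _, hb⟩
  have h3 := h2.context [] (desc (m + 2) m j ++ w)
  refine h3.of_commEquiv ?_
  have := h1.context (desc (m + 2) (m + 1) (m + 1) ++ lastPow (m + 2) k ++
    desc (m + 2) (m + 1) (m + 1)) w
  simpa only [List.append_assoc, List.nil_append] using this

theorem colorWord_eq_last_append [NeZero d] {j : ℕ} {cs : List (ZMod d)} (h : cs.sum ≠ 0) :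
    ∃ w, colorWord n j cs = desc n n n ++ w := by
  induction cs generalizing j with
  | nil => simp at h
  | cons c cs ih =>
    rw [colorWord, colorBlock]
    split_ifs with hc
    · rw [List.sum_cons, hc, zero_add] at h
      exact ih h
    · obtain ⟨k, hk⟩ : ∃ k, c.val = k + 1 :=
        Nat.exists_eq_add_one.2 (Nat.pos_of_ne_zero fun h => hc ((ZMod.val_eq_zero c).1 h))
      rw [descPow_eq, hk]
      exact ⟨_, by simp only [lastPow, List.replicate_succ, List.flatten_cons,
        List.append_assoc]; rfl⟩

/-- For `i < n - 1` the first nonempty suffix block already gives a type `A` braid. For `i = n - 1`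
a further `s_n` is needed, hence a second nonzero color; this is where the vanishing of the sum
enters. -/
theorem hasBraid_colorWord [NeZero d] {j : ℕ} {cs : List (ZMod d)} (hj : 1 ≤ j)
    (h : j + cs.length = n + 1) (hs : cs.sum = 0) {i m : ℕ} (hi : firstColor j cs < i)
    (him : i ≤ m) (hm : m < n) : HasBraid (desc n m i ++ colorWord n j cs) := by
  induction cs generalizing j with
  -- Without nonzero colors the bound is `n`, and no prefix block can start above it.
  | nil => simp only [List.length_nil, firstColor] at h hi; omega
  | cons c cs ih =>
    simp only [List.length_cons] at h
    rw [firstColor] at hi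
    rw [colorWord, colorBlock]
    split_ifs with hc
    · rw [if_pos hc] at hi
      rw [List.sum_cons, hc, zero_add] at hs
      exact ih (by omega) (by omega) hs hi
    · rw [if_neg hc] at hi
      by_cases hin : i + 1 < n
      · have := (hasBraid_desc (n := n) (i := i) (m := m) (i' := j) (m' := n - 1) (k := c.val)
          (by omega) (by omega) him (by omega) (by omega)).context [] (colorWord n (j + 1) cs)
        simpa [descPow_eq] using this
      · obtain rfl : i = n - 1 := by omega
        obtain rfl : m = n - 1 := by omega
        -- The remaining colors sum to `-c ≠ 0`, so the rest of the suffix is nonempty and begins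
        -- with `s_n`.
        obtain ⟨w, hw⟩ := colorWord_eq_last_append (n := n) (j := j + 1) (cs := cs)
          (fun h0 => hc (by rw [List.sum_cons, h0, add_zero] at hs; exact hs))
        rw [hw]
        exact hasBraid_last (by omega) (by omega) w

/-- Blocks are peeled off from the right. A block with `i > κ` conflicts with `w`; otherwise it
becomes part of `w` with new bound `i - 1`, because an earlier block ending in some `i' ≥ i`
conflicts with it by `hasBraid_desc`. -/
theorem hasBraid_prefix {κ M : ℕ} {l : List ℕ} {w : List (Fin n)}
    (hw : ∀ i m, κ < i → i ≤ m → m < M → HasBraid (desc n m i ++ w)) (hv : ValidPrefix l)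
    (hM : l.length < M) (hMn : M ≤ n) (hl : ¬ AllowedPrefix κ l) :
    HasBraid (prefixWord n l ++ w) := by
  induction l generalizing κ M w with
  | nil => exact absurd trivial hl
  | cons i l ih =>
    obtain ⟨⟨hi1, hi2⟩, hv⟩ := hv
    simp only [List.length_cons] at hM
    rw [prefixWord, List.append_assoc]
    rcases hi2.eq_or_lt with hi | hi
    · rw [desc_nil (by omega), List.nil_append]
      exact ih hw hv (by omega) hMn fun h => hl (.inl ⟨hi, h⟩)
    · by_cases hκ : κ < i
      · simpa using (hw i (l.length + 1) hκ (by omega) hM).context (prefixWord n l) []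
      · refine ih (κ := i - 1) (M := l.length + 1) (fun i' m' h1 h2 h3 => ?_) hv (by omega)
          (by omega) fun h => hl (.inr ⟨⟨hi1, by omega, by omega⟩, h⟩)
        have := (hasBraid_desc (n := n) (i := i') (m := m') (i' := i) (m' := l.length + 1) (k := 0)
          (by omega) (by omega) h2 (by omega) (by omega)).context [] w
        simpa [lastPow] using this

theorem allowedPrefix_of_fullyCommutative (hd : 2 ≤ d) (hn : 1 ≤ n) {l : List ℕ}
    {cs : List (ZMod d)} (hl : ValidPrefix l) (h1 : l.length = n - 1) (h2 : cs.length = n)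
    (hs : cs.sum = 0) (h : FullyCommutative d n (eval d n (canonicalWord n l cs))) :
    AllowedPrefix (firstColor 1 cs) l := by
  have : NeZero d := ⟨by omega⟩
  by_contra hc
  refine (hasBraid_prefix (n := n) (M := n) (w := colorWord n 1 cs) (fun i m h3 h4 h5 => ?_) hl
    (by omega) le_rfl hc).not_fullyCommutative (canonicalWord_reduced hd hn hl h1 h2) h
  exact hasBraid_colorWord le_rfl (by omega) hs h3 h4 h5

end FullCommutativity

/-! ### The embedding of `G(d,d,n)` -/

section Embedding

variable {d n : ℕ}

/-- The generators of `G(d,d,n)`. -/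
def sTilde (d n : ℕ) (i : Fin n) : GD d n := PresentedGroup.of i

theorem sTilde_rel {r : FreeGroup (Fin n)} (h : RelD d n r) : FreeGroup.lift (sTilde d n) r = 1 := by
  have h1 : FreeGroup.lift (sTilde d n) = PresentedGroup.mk {r : FreeGroup (Fin n) | RelD d n r} := by
    ext i
    simp [sTilde, PresentedGroup.of]
  rw [h1]
  exact PresentedGroup.one_of_mem h

theorem sTilde_sq (i : Fin n) : sTilde d n i * sTilde d n i = 1 := by
  simpa [pow_two] using sTilde_rel (RelD.sq (d := d) i)

theorem sTilde_pow_last {t a : Fin n} (ht : t.val + 1 = n) (ha : a.val + 2 = n) :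
    (sTilde d n t * sTilde d n a) ^ d = 1 := by
  simpa using sTilde_rel (RelD.pow_last (d := d) t a ht ha)

theorem sTilde_comm {i j : Fin n} (hij : j.val + 1 < i.val) (hi : i.val + 1 < n) :
    sTilde d n i * sTilde d n j = sTilde d n j * sTilde d n i := by
  have := sTilde_rel (RelD.comm (d := d) i j hij hi)
  simp only [map_mul, map_inv, FreeGroup.lift_apply_of] at this
  exact mul_inv_eq_one.mp this

theorem sTilde_comm_last {t j : Fin n} (ht : t.val + 1 = n) (hj : j.val + 1 + 3 ≤ n) :
    sTilde d n t * sTilde d n j = sTilde d n j * sTilde d n t := by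
  have := sTilde_rel (RelD.comm_last (d := d) t j ht hj)
  simp only [map_mul, map_inv, FreeGroup.lift_apply_of] at this
  exact mul_inv_eq_one.mp this

theorem sTilde_braid {i j : Fin n} (hij : j.val = i.val + 1) (hj : j.val + 1 < n) :
    sTilde d n j * sTilde d n i * sTilde d n j = sTilde d n i * sTilde d n j * sTilde d n i := by
  have := sTilde_rel (RelD.braid (d := d) i j hij hj)
  simp only [map_mul, map_inv, FreeGroup.lift_apply_of] at this
  exact mul_inv_eq_one.mp this

theorem sTilde_braid_last {t b : Fin n} (ht : t.val + 1 = n) (hb : b.val + 3 = n) :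
    sTilde d n t * sTilde d n b * sTilde d n t = sTilde d n b * sTilde d n t * sTilde d n b := by
  have := sTilde_rel (RelD.braid_last (d := d) t b ht hb)
  simp only [map_mul, map_inv, FreeGroup.lift_apply_of] at this
  exact mul_inv_eq_one.mp this

theorem sTilde_triangle {t a b : Fin n} (ht : t.val + 1 = n) (ha : a.val + 2 = n)
    (hb : b.val + 3 = n) :
    (sTilde d n t * sTilde d n a * sTilde d n b) ^ 2 = (sTilde d n b * sTilde d n t * sTilde d n a) ^ 2 := by
  have := sTilde_rel (RelD.triangle (d := d) t a b ht ha hb)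
  simp only [map_mul, map_inv, map_pow, FreeGroup.lift_apply_of] at this
  exact mul_inv_eq_one.mp this

/-- Conjugation by `s_n⁻¹` sends `s̃_n` to `s̃_n s̃_{n-1} s̃_n`. The triangle relation ensures that
this element again satisfies the braid relation with `s̃_{n-2}`. -/
theorem braid_of_triangle {G : Type*} [Group G] {a b c : G} (haa : a * a = 1) (hbb : b * b = 1)
    (hcc : c * c = 1) (hac : a * c * a = c * a * c) (hbc : b * c * b = c * b * c)
    (h : (b * a * c) ^ 2 = (c * b * a) ^ 2) :
    (b * a * b) * c * (b * a * b) = c * (b * a * b) * c := by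
  have e1 : a * c * b * a * c * a = b * c * b * a * c * b := by
    have h' : b * a * c * b * a * c = c * b * a * c * b * a := by
      simpa only [pow_two, mul_assoc] using h
    calc a * c * b * a * c * a = b * b * (a * c * b * a * c) * a := by rw [hbb, one_mul]
      _ = b * (b * a * c * b * a * c) * a := by simp only [mul_assoc]
      _ = b * c * b * a * c * b * (a * a) := by rw [h']; simp only [mul_assoc]
      _ = _ := by rw [haa, mul_one]
  have e2 : a * (b * c * b) * a = (b * c * b) * a * (b * c * b) := by
    calc a * (b * c * b) * a = a * (c * b * c) * a := by rw [hbc]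
      _ = a * c * b * (c * a * c) * c := by simp only [mul_assoc, hcc, mul_one]
      _ = (a * c * b * a * c * a) * c := by rw [← hac]; simp only [mul_assoc]
      _ = b * c * b * a * (c * b * c) := by rw [e1]; simp only [mul_assoc]
      _ = (b * c * b) * a * (b * c * b) := by rw [hbc]
  calc (b * a * b) * c * (b * a * b) = b * (a * (b * c * b) * a) * b := by simp only [mul_assoc]
    _ = b * ((b * c * b) * a * (b * c * b)) * b := by rw [e2]
    _ = (b * b) * c * (b * a * b) * c * (b * b) := by simp only [mul_assoc]
    _ = c * (b * a * b) * c := by rw [hbb, one_mul, mul_one]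

/-- The images of the generators of `G(d,d,n)` under conjugation by `s_n⁻¹`. -/
def conjGen (d n : ℕ) (i : Fin n) : GD d n :=
  if h : i.val + 1 = n then
    sTilde d n i * sTilde d n ⟨i.val - 1, by omega⟩ * sTilde d n i
  else if h : i.val + 2 = n then sTilde d n ⟨i.val + 1, by omega⟩ else sTilde d n i

theorem conjGen_last {t a : Fin n} (ht : t.val + 1 = n) (ha : a.val + 2 = n) :
    conjGen d n t = sTilde d n t * sTilde d n a * sTilde d n t := by
  have : (⟨t.val - 1, by omega⟩ : Fin n) = a := by ext; simp; omega
  rw [conjGen, dif_pos ht, this]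

theorem conjGen_penultimate {t a : Fin n} (ht : t.val + 1 = n) (ha : a.val + 2 = n) :
    conjGen d n a = sTilde d n t := by
  have : (⟨a.val + 1, by omega⟩ : Fin n) = t := by ext; simp; omega
  rw [conjGen, dif_neg (by omega), dif_pos ha, this]

theorem conjGen_of_lt {i : Fin n} (hi : i.val + 2 < n) : conjGen d n i = sTilde d n i := by
  rw [conjGen, dif_neg (by omega), dif_neg (by omega)]

theorem conjGen_rel (hn : 3 ≤ n) :
    ∀ r ∈ {r : FreeGroup (Fin n) | RelD d n r}, FreeGroup.lift (conjGen d n) r = 1 := by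
  intro r hr
  obtain ⟨t, ht⟩ : ∃ t : Fin n, t.val + 1 = n := ⟨⟨n - 1, by omega⟩, by simp; omega⟩
  obtain ⟨a, ha⟩ : ∃ a : Fin n, a.val + 2 = n := ⟨⟨n - 2, by omega⟩, by simp; omega⟩
  have htt := sTilde_sq (d := d) t
  cases hr with
  | sq i =>
    simp only [map_pow, FreeGroup.lift_apply_of]
    rcases (show i.val + 1 = n ∨ i.val + 2 = n ∨ i.val + 2 < n by omega) with hi | hi | hi
    · obtain rfl : i = t := by ext; omega
      rw [conjGen_last hi ha, pow_two]
      calc sTilde d n i * sTilde d n a * sTilde d n i * (sTilde d n i * sTilde d n a * sTilde d n i)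
          = sTilde d n i * (sTilde d n a * (sTilde d n i * sTilde d n i) * sTilde d n a) * sTilde d n i := by
            simp only [mul_assoc]
        _ = 1 := by rw [htt, mul_one, sTilde_sq, mul_one, htt]
    · rw [conjGen_penultimate ht hi, pow_two, htt]
    · rw [conjGen_of_lt hi, pow_two, sTilde_sq]
  | pow_last t' a' ht' ha' =>
    obtain rfl : t' = t := by ext; omega
    obtain rfl : a' = a := by ext; omega
    simp only [map_pow, map_mul, FreeGroup.lift_apply_of]
    rw [conjGen_last ht ha, conjGen_penultimate ht ha, mul_assoc, htt, mul_one, sTilde_pow_last ht ha]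
  | comm i j hij hi =>
    simp only [map_mul, map_inv, FreeGroup.lift_apply_of, mul_inv_eq_one]
    rw [conjGen_of_lt (i := j) (by omega)]
    rcases (show i.val + 2 = n ∨ i.val + 2 < n by omega) with hi' | hi'
    · rw [conjGen_penultimate ht hi', sTilde_comm_last ht (by omega)]
    · rw [conjGen_of_lt hi', sTilde_comm hij hi]
  | comm_last t' j ht' hj =>
    obtain rfl : t' = t := by ext; omega
    simp only [map_mul, map_inv, FreeGroup.lift_apply_of, mul_inv_eq_one]
    rw [conjGen_of_lt (i := j) (by omega), conjGen_last ht ha]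
    have h1 : Commute (sTilde d n t') (sTilde d n j) := sTilde_comm_last ht hj
    have h2 : Commute (sTilde d n a) (sTilde d n j) := sTilde_comm (by omega) (by omega)
    exact (h1.mul_left h2).mul_left h1
  | braid i j hij hj =>
    simp only [map_mul, map_inv, FreeGroup.lift_apply_of, mul_inv_eq_one]
    rw [conjGen_of_lt (i := i) (by omega)]
    rcases (show j.val + 2 = n ∨ j.val + 2 < n by omega) with hj' | hj'
    · rw [conjGen_penultimate ht hj', sTilde_braid_last ht (by omega)]
    · rw [conjGen_of_lt hj', sTilde_braid hij hj]
  | braid_last t' b ht' hb =>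
    obtain rfl : t' = t := by ext; omega
    simp only [map_mul, map_inv, FreeGroup.lift_apply_of, mul_inv_eq_one]
    rw [conjGen_of_lt (i := b) (by omega), conjGen_last ht ha]
    exact braid_of_triangle (sTilde_sq a) htt (sTilde_sq b) (sTilde_braid (by omega) (by omega))
      (sTilde_braid_last ht hb) (sTilde_triangle ht ha hb)
  | triangle t' a' b ht' ha' hb =>
    obtain rfl : t' = t := by ext; omega
    obtain rfl : a' = a := by ext; omega
    simp only [map_mul, map_inv, map_pow, FreeGroup.lift_apply_of, mul_inv_eq_one]
    rw [conjGen_of_lt (i := b) (by omega), conjGen_last ht ha, conjGen_penultimate ht ha,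
      mul_assoc (sTilde d n t' * sTilde d n a') (sTilde d n t') (sTilde d n t'), htt, mul_one]
    rw [mul_assoc (sTilde d n b), mul_assoc (sTilde d n t' * sTilde d n a') (sTilde d n t') (sTilde d n t'), htt, mul_one,
      sTilde_triangle ht ha hb, mul_assoc]

/-- The endomorphism of `G(d,d,n)` induced by conjugation with `s_n⁻¹`. -/
def conjHom (d : ℕ) {n : ℕ} (hn : 3 ≤ n) : Monoid.End (GD d n) :=
  PresentedGroup.toGroup (conjGen_rel hn)

theorem conjHom_sTilde (hn : 3 ≤ n) (i : Fin n) : conjHom d hn (sTilde d n i) = conjGen d n i :=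
  PresentedGroup.toGroup.of _

/-- The product `s̃_n s̃_{n-1}` is fixed, and both of its factors are multiplied by it on the left.
Its order divides `d`, so the endomorphism has trivial `d`-th power and is invertible. -/
theorem conjHom_pow_sTilde (hn : 3 ≤ n) {t a : Fin n} (ht : t.val + 1 = n) (ha : a.val + 2 = n)
    (k : ℕ) (i : Fin n) : (conjHom d hn ^ k) (sTilde d n i) =
      if i.val + 2 < n then sTilde d n i else (sTilde d n t * sTilde d n a) ^ k * sTilde d n i := by
  have hta : conjHom d hn (sTilde d n t * sTilde d n a) = sTilde d n t * sTilde d n a := by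
    rw [map_mul, conjHom_sTilde, conjHom_sTilde, conjGen_last ht ha, conjGen_penultimate ht ha, mul_assoc,
      sTilde_sq, mul_one]
  induction k with
  | zero => simp
  | succ k ih =>
    rw [pow_succ', Monoid.End.coe_mul, Function.comp_apply, ih]
    split_ifs with hi
    · rw [conjHom_sTilde, conjGen_of_lt hi]
    · rw [map_mul, map_pow, hta, conjHom_sTilde, pow_succ, mul_assoc]
      rcases (show i.val + 1 = n ∨ i.val + 2 = n by omega) with hi | hi
      · obtain rfl : i = t := by ext; omega
        rw [conjGen_last ht ha, mul_assoc]
      · obtain rfl : i = a := by ext; omega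
        rw [conjGen_penultimate ht ha, mul_assoc, sTilde_sq, mul_one]

theorem conjHom_pow (hn : 3 ≤ n) : conjHom d hn ^ d = 1 := by
  have ht : (⟨n - 1, by omega⟩ : Fin n).val + 1 = n := by simp; omega
  have ha : (⟨n - 2, by omega⟩ : Fin n).val + 2 = n := by simp; omega
  refine PresentedGroup.ext fun i => ?_
  show (conjHom d hn ^ d) (sTilde d n i) = sTilde d n i
  rw [conjHom_pow_sTilde hn ht ha, sTilde_pow_last ht ha, one_mul, ite_self]

/-- The automorphism of `G(d,d,n)` induced by conjugation with `s_n⁻¹`. -/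
def conjAut (hd : 2 ≤ d) (hn : 3 ≤ n) : MulAut (GD d n) :=
  MonoidHom.toMulEquiv (conjHom d hn) (conjHom d hn ^ (d - 1) : Monoid.End (GD d n))
    (by
      have : conjHom d hn ^ (d - 1) * conjHom d hn = 1 := by
        rw [← pow_succ, Nat.sub_add_cancel (by omega), conjHom_pow]
      exact this)
    (by
      have : conjHom d hn * conjHom d hn ^ (d - 1) = 1 := by
        rw [← pow_succ', Nat.sub_add_cancel (by omega), conjHom_pow]
      exact this)

theorem conjAut_apply (hd : 2 ≤ d) (hn : 3 ≤ n) (g : GD d n) :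
    conjAut hd hn g = conjHom d hn g := rfl

theorem conjAut_pow (hd : 2 ≤ d) (hn : 3 ≤ n) : conjAut hd hn ^ d = 1 := by
  have h : ∀ k g, (conjAut hd hn ^ k) g = (conjHom d hn ^ k) g := by
    intro k
    induction k with
    | zero => intro g; rfl
    | succ k ih =>
      intro g
      rw [pow_succ, pow_succ, MulAut.mul_apply, ih, Monoid.End.coe_mul]
      rfl
  ext g
  rw [h, conjHom_pow]
  rfl

/-- The images of the generators of `G(d,1,n)` in the holomorph of `G(d,d,n)`. -/
def holGen (hd : 2 ≤ d) (hn : 3 ≤ n) (i : Fin n) :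
    GD d n ⋊[MonoidHom.id (MulAut (GD d n))] MulAut (GD d n) :=
  if i.val + 1 = n then (SemidirectProduct.inr (conjAut hd hn))⁻¹
  else SemidirectProduct.inl (sTilde d n i)

theorem hol_conj (hd : 2 ≤ d) (hn : 3 ≤ n) (i : Fin n) :
    (SemidirectProduct.inr (conjAut hd hn) * SemidirectProduct.inl (sTilde d n i) *
      (SemidirectProduct.inr (conjAut hd hn))⁻¹ :
      GD d n ⋊[MonoidHom.id (MulAut (GD d n))] MulAut (GD d n)) =
      SemidirectProduct.inl (conjGen d n i) := by
  rw [← conjHom_sTilde hn, ← conjAut_apply hd hn, ← map_inv]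
  exact (SemidirectProduct.inl_aut (φ := MonoidHom.id (MulAut (GD d n))) _ _).symm

theorem holGen_rel (hd : 2 ≤ d) (hn : 3 ≤ n) :
    ∀ r ∈ {r : FreeGroup (Fin n) | Rel1 d n r}, FreeGroup.lift (holGen hd hn) r = 1 := by
  intro r hr
  have hl : ∀ i : Fin n, i.val + 1 < n → holGen hd hn i = SemidirectProduct.inl (sTilde d n i) :=
    fun i hi => by rw [holGen, if_neg hi.ne]
  cases hr with
  | pow_last t ht =>
    simp only [map_pow, FreeGroup.lift_apply_of]
    rw [holGen, if_pos ht, inv_pow, ← map_pow, conjAut_pow, map_one, inv_one]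
  | sq i hi =>
    simp only [map_pow, FreeGroup.lift_apply_of]
    rw [hl i hi, pow_two, ← map_mul, sTilde_sq, map_one]
  | comm i j hij =>
    simp only [map_mul, map_inv, FreeGroup.lift_apply_of, mul_inv_eq_one]
    rw [hl j (by omega)]
    by_cases hi : i.val + 1 = n
    · rw [holGen, if_pos hi]
      have := hol_conj hd hn j
      rw [conjGen_of_lt (by omega), mul_inv_eq_iff_eq_mul] at this
      exact (Commute.inv_left this).eq
    · rw [hl i (by omega), ← map_mul, sTilde_comm hij (by omega), map_mul]
  | braid i j hij hj =>
    simp only [map_mul, map_inv, FreeGroup.lift_apply_of, mul_inv_eq_one]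
    rw [hl i (by omega), hl j hj]
    simp only [← map_mul]
    rw [sTilde_braid hij hj]
  | braid_last t a ht ha =>
    simp only [map_mul, map_inv, FreeGroup.lift_apply_of, mul_inv_eq_one]
    have h1 := hol_conj hd hn a
    have h2 := hol_conj hd hn t
    rw [conjGen_penultimate ht ha] at h1
    rw [conjGen_last ht ha, map_mul, map_mul] at h2
    have h3 : (SemidirectProduct.inl (sTilde d n t) * SemidirectProduct.inl (sTilde d n t) :
      GD d n ⋊[MonoidHom.id (MulAut (GD d n))] MulAut (GD d n)) = 1 := by
      rw [← map_mul, sTilde_sq, map_one]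
    rw [hl a (by omega), holGen, if_pos ht]
    generalize (SemidirectProduct.inr (conjAut hd hn) :
      GD d n ⋊[MonoidHom.id (MulAut (GD d n))] MulAut (GD d n)) = S at *
    generalize (SemidirectProduct.inl (sTilde d n t) :
      GD d n ⋊[MonoidHom.id (MulAut (GD d n))] MulAut (GD d n)) = B at *
    generalize (SemidirectProduct.inl (sTilde d n a) :
      GD d n ⋊[MonoidHom.id (MulAut (GD d n))] MulAut (GD d n)) = A at *
    -- Since `s_n` maps to `S⁻¹`, multiplying both sides of the relation by `S * S` expresses them
    -- through the conjugates `S A S⁻¹ = B` and `S B S⁻¹ = B A B`.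
    have e1 : S * S * (S⁻¹ * A * S⁻¹ * A) = B * A := by
      rw [← h1]; group
    have e2 : S * S * (A * S⁻¹ * A * S⁻¹) = B * A := by
      calc S * S * (A * S⁻¹ * A * S⁻¹) = (S * (S * A * S⁻¹) * S⁻¹) * (S * A * S⁻¹) := by group
        _ = B * A * (B * B) := by rw [h1, h2]; group
        _ = B * A := by rw [h3, mul_one]
    exact mul_left_cancel (e1.trans e2.symm)

/-! ### Injectivity and image of `ι` -/

theorem iota_sTilde (hd : 2 ≤ d) (hn : 3 ≤ n) (i : Fin n) :
    iota d n hd hn (sTilde d n i) = iotaGen d n i :=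
  PresentedGroup.toGroup.of _

/-- Followed by the map to the holomorph, `ι` becomes the canonical inclusion of `G(d,d,n)`. This is
checked on generators, where `s_n⁻¹ s_{n-1} s_n` turns into the automorphism applied to `s̃_{n-1}`.
-/
theorem iota_injective (hd : 2 ≤ d) (hn : 3 ≤ n) : Function.Injective (iota d n hd hn) := by
  have h : (PresentedGroup.toGroup (holGen_rel hd hn)).comp (iota d n hd hn) =
      SemidirectProduct.inl := by
    refine PresentedGroup.ext fun i => ?_
    show PresentedGroup.toGroup (holGen_rel hd hn) (iota d n hd hn (sTilde d n i)) =
      SemidirectProduct.inl (sTilde d n i)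
    have hs : ∀ j, PresentedGroup.toGroup (holGen_rel hd hn) (s d n j) = holGen hd hn j :=
      fun j => PresentedGroup.toGroup.of _
    rw [iota_sTilde]
    by_cases hi : i.val + 1 = n
    · have ha : (⟨n - 2, by omega⟩ : Fin n).val + 2 = n := by simp; omega
      rw [iotaGen_last hd hi ha, map_mul, map_mul, map_inv, hs, hs]
      have := hol_conj hd hn ⟨n - 2, by omega⟩
      rw [conjGen_penultimate hi ha] at this
      rw [← this]
      simp only [holGen, hi, if_true, inv_inv]
      rw [if_neg (by omega)]
    · rw [iotaGen_of_lt (by omega), hs, holGen, if_neg hi]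
  have h2 : Function.Injective ((PresentedGroup.toGroup (holGen_rel hd hn)).comp
      (iota d n hd hn)) := by
    rw [h]; exact SemidirectProduct.inl_injective
  rw [MonoidHom.coe_comp] at h2
  exact h2.of_comp

theorem iota_conjAut (hd : 2 ≤ d) (hn : 3 ≤ n) {t : Fin n} (ht : t.val + 1 = n) (g : GD d n) :
    iota d n hd hn (conjAut hd hn g) = (s d n t)⁻¹ * iota d n hd hn g * s d n t := by
  have ha : (⟨n - 2, by omega⟩ : Fin n).val + 2 = n := by simp; omega
  generalize (⟨n - 2, by omega⟩ : Fin n) = a at ha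
  have h : (iota d n hd hn).comp (conjAut hd hn).toMonoidHom =
      (MulAut.conj (s d n t)⁻¹).toMonoidHom.comp (iota d n hd hn) := by
    refine PresentedGroup.ext fun i => ?_
    show iota d n hd hn (conjHom d hn (sTilde d n i)) =
      (s d n t)⁻¹ * iota d n hd hn (sTilde d n i) * (s d n t)⁻¹⁻¹
    rw [inv_inv, conjHom_sTilde, iota_sTilde]
    rcases (show i.val + 1 = n ∨ i.val + 2 = n ∨ i.val + 2 < n by omega) with hi | hi | hi
    · obtain rfl : i = t := by ext; omega
      rw [conjGen_last hi ha, map_mul, map_mul, iota_sTilde, iota_sTilde, iotaGen_last hd hi ha,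
        iotaGen_of_lt (by omega)]
      have haa := s_sq (d := d) (i := a) (by omega)
      have hta := s_braid_last (d := d) hi ha
      generalize s d n i = t at *
      generalize s d n a = a at *
      have ha : a⁻¹ = a := inv_eq_of_mul_eq_one_left haa
      have c : Commute t (a * t * a⁻¹) := by
        show t * (a * t * a⁻¹) = (a * t * a⁻¹) * t
        rw [ha]
        simpa only [mul_assoc] using hta
      calc t⁻¹ * a * t * a * (t⁻¹ * a * t) = t⁻¹ * a * (t * (a * t⁻¹ * a)) * t := by group
        _ = t⁻¹ * a * (t * (a * t * a⁻¹)⁻¹) * t := by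
          congr 3
          rw [mul_inv_rev, mul_inv_rev, inv_inv, ha, ← mul_assoc]
        _ = t⁻¹ * a * ((a * t * a⁻¹)⁻¹ * t) * t := by rw [c.inv_right.eq]
        _ = t⁻¹ * t⁻¹ * a⁻¹ * t * t := by rw [mul_inv_rev, mul_inv_rev, inv_inv]; nth_rw 1 [← ha]; group
        _ = t⁻¹ * (t⁻¹ * a * t) * t := by rw [ha]; group
    · rw [conjGen_penultimate ht hi, iota_sTilde, iotaGen_last hd ht hi, iotaGen_of_lt (by omega)]
    · rw [conjGen_of_lt hi, iota_sTilde, iotaGen_of_lt (by omega)]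
      have : Commute (s d n t) (s d n i) := s_comm (by omega)
      rw [this.inv_left.eq, inv_mul_cancel_right]
  exact DFunLike.congr_fun h g

/-- The image of `ι` is normalized by `s_n` and contains the other generators, so all letters `s_n`
can be collected on the right. -/
theorem eval_eq_iota_mul (hd : 2 ≤ d) (hn : 3 ≤ n) {t : Fin n} (ht : t.val + 1 = n)
    (w : List (Fin n)) : ∃ g, eval d n w = iota d n hd hn g * s d n t ^ w.count t := by
  have hpow : ∀ k g, ∃ g', s d n t ^ k * iota d n hd hn g = iota d n hd hn g' * s d n t ^ k := by
    intro k
    induction k with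
    | zero => intro g; exact ⟨g, by simp⟩
    | succ k ih =>
      intro g
      -- The automorphism is conjugation by `s_n⁻¹`; taking a preimage of `g` allows one `s_n` to
      -- pass from left to right.
      obtain ⟨g₁, rfl⟩ := (conjAut hd hn).surjective g
      obtain ⟨g₂, h₂⟩ := ih g₁
      refine ⟨g₂, ?_⟩
      rw [iota_conjAut hd hn ht, pow_succ]
      calc s d n t ^ k * s d n t * ((s d n t)⁻¹ * iota d n hd hn g₁ * s d n t)
          = s d n t ^ k * iota d n hd hn g₁ * s d n t := by group
        _ = _ := by rw [h₂, mul_assoc]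
  induction w using List.reverseRecOn with
  | nil => exact ⟨1, by simp [eval]⟩
  | append_singleton w p ih =>
    obtain ⟨g, hg⟩ := ih
    rw [eval_append, hg]
    have e : eval d n [p] = s d n p := by simp [eval]
    rw [e, List.count_append]
    by_cases hp : p = t
    · subst hp
      exact ⟨g, by simp [pow_succ, mul_assoc]⟩
    · obtain ⟨g', hg'⟩ := hpow (w.count t) (sTilde d n p)
      have hp' : p.val + 1 ≠ n := fun h => hp (by ext; omega)
      rw [iota_sTilde, iotaGen_of_lt (by omega)] at hg'
      refine ⟨g * g', ?_⟩
      rw [mul_assoc, hg', map_mul, mul_assoc]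
      simp [hp]

/-- The images of the generators under `lastCount`. -/
def lastCountGen (d n : ℕ) (i : Fin n) : Multiplicative (ZMod d) :=
  if i.val + 1 = n then Multiplicative.ofAdd 1 else 1

theorem lastCountGen_rel : ∀ r ∈ {r : FreeGroup (Fin n) | Rel1 d n r},
    FreeGroup.lift (lastCountGen d n) r = 1 := by
  intro r hr
  cases hr with
  | pow_last t ht =>
    simp only [map_pow, FreeGroup.lift_apply_of, lastCountGen, ht, if_true, ← ofAdd_nsmul]
    simp
  | sq i hi =>
    simp only [map_pow, FreeGroup.lift_apply_of, lastCountGen, hi.ne, if_false, one_pow]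
  | comm i j hij =>
    simp only [map_mul, map_inv, FreeGroup.lift_apply_of, mul_inv_eq_one]
    exact mul_comm _ _
  | braid i j hij hj =>
    simp only [map_mul, map_inv, FreeGroup.lift_apply_of, mul_inv_eq_one, lastCountGen, hj.ne,
      show i.val + 1 ≠ n by omega, if_false]
  | braid_last t a ht ha =>
    simp only [map_mul, map_inv, FreeGroup.lift_apply_of, mul_inv_eq_one, lastCountGen, ht,
      show a.val + 1 ≠ n by omega, if_false, if_true, mul_one, one_mul]

/-- The homomorphism counting the letters `s_n` modulo `d`. -/
def lastCount (d n : ℕ) : G1 d n →* Multiplicative (ZMod d) :=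
  PresentedGroup.toGroup lastCountGen_rel

theorem lastCount_s (i : Fin n) : lastCount d n (s d n i) = lastCountGen d n i :=
  PresentedGroup.toGroup.of _

theorem lastCount_iota (hd : 2 ≤ d) (hn : 3 ≤ n) (g : GD d n) :
    lastCount d n (iota d n hd hn g) = 1 := by
  have h : (lastCount d n).comp (iota d n hd hn) = 1 := by
    refine PresentedGroup.ext fun i => ?_
    show lastCount d n (iota d n hd hn (sTilde d n i)) = 1
    rw [iota_sTilde]
    by_cases hi : i.val + 1 = n
    · have ha : (⟨n - 2, by omega⟩ : Fin n).val + 2 = n := by simp; omega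
      rw [iotaGen_last hd hi ha, map_mul, map_mul, map_inv, lastCount_s (⟨n - 2, _⟩ : Fin n),
        lastCountGen, if_neg (by simp; omega), mul_one, inv_mul_cancel]
    · rw [iotaGen_of_lt (by omega), lastCount_s, lastCountGen, if_neg hi]
  exact DFunLike.congr_fun h g

theorem lastCount_eval {t : Fin n} (ht : t.val + 1 = n) (w : List (Fin n)) :
    lastCount d n (eval d n w) = Multiplicative.ofAdd (w.count t : ZMod d) := by
  induction w with
  | nil => simp [eval]
  | cons p w ih =>
    have e : eval d n (p :: w) = s d n p * eval d n w := by simp [eval]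
    rw [e, map_mul, ih, lastCount_s, lastCountGen, List.count_cons]
    by_cases hp : p = t
    · subst hp
      rw [if_pos ht, ← ofAdd_add]
      simp [add_comm]
    · have hp' : p.val + 1 ≠ n := fun h => hp (by ext; omega)
      simp [hp, hp']

theorem eval_mem_range_iff (hd : 2 ≤ d) (hn : 3 ≤ n) {t : Fin n} (ht : t.val + 1 = n)
    (w : List (Fin n)) : eval d n w ∈ (iota d n hd hn).range ↔ (w.count t : ZMod d) = 0 := by
  constructor
  · rintro ⟨g, hg⟩
    have := lastCount_eval (d := d) ht w
    rw [← hg, lastCount_iota] at this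
    exact Multiplicative.ofAdd.injective this.symm
  · intro h
    obtain ⟨g, hg⟩ := eval_eq_iota_mul hd hn ht w
    obtain ⟨k, hk⟩ := (ZMod.natCast_eq_zero_iff _ _).1 h
    rw [hk, pow_mul, s_pow_last ht, one_pow, mul_one] at hg
    exact ⟨g, hg.symm⟩

theorem count_canonicalWord [NeZero d] {t : Fin n} (ht : t.val + 1 = n) {l : List ℕ}
    (hl : l.length < n) (cs : List (ZMod d)) :
    ((canonicalWord n l cs).count t : ZMod d) = cs.sum := by
  have h1 : (prefixWord n l).count t = 0 := by
    rw [List.count_eq_zero]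
    intro h
    have := mem_prefixWord h
    omega
  have h2 : ∀ k j, (descPow n k j).count t = k := by
    intro k j
    rw [descPow_eq, List.count_append, lastPow_eq_replicate (by omega),
      show (⟨n - 1, by omega⟩ : Fin n) = t by ext; simp; omega, List.count_replicate_self]
    simp only [Nat.add_eq_left, List.count_eq_zero]
    intro h
    rw [mem_desc] at h
    omega
  have h3 : ∀ j, ((colorWord n j cs).count t : ZMod d) = cs.sum := by
    induction cs with
    | nil => simp [colorWord]
    | cons c cs ih =>
      intro j
      rw [colorWord, List.count_append, Nat.cast_add, ih, List.sum_cons, colorBlock]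
      split_ifs with hc
      · simp [hc]
      · rw [h2, ZMod.natCast_zmod_val]
  rw [canonicalWord, List.count_append, h1, zero_add, h3]

end Embedding

/-! ### The Catalan triangle -/

section Catalan

theorem catalanTriangle_zero (n : ℕ) : catalanTriangle n 0 = 1 := by
  have h : (n.factorial : ℚ) ≠ 0 := by exact_mod_cast n.factorial_ne_zero
  have h' : (n : ℚ) + 1 ≠ 0 := by positivity
  simp only [catalanTriangle, add_zero, Nat.factorial_zero, Nat.factorial_succ]
  push_cast
  field_simp
  ring

theorem catalanTriangle_succ (n k : ℕ) :
    catalanTriangle (n + 1) (k + 1) = catalanTriangle (n + 1) k + catalanTriangle n (k + 1) := by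
  have h1 : (k.factorial : ℚ) ≠ 0 := by exact_mod_cast k.factorial_ne_zero
  have h2 : ((n + 1).factorial : ℚ) ≠ 0 := by exact_mod_cast (n + 1).factorial_ne_zero
  have h3 : (k : ℚ) + 1 ≠ 0 := by positivity
  have h4 : (n : ℚ) + 1 + 1 ≠ 0 := by positivity
  have e1 : ((n + 1 + (k + 1)).factorial : ℚ) = (n + k + 2) * (n + k + 1).factorial := by
    rw [show n + 1 + (k + 1) = n + k + 1 + 1 by ring, Nat.factorial_succ]
    push_cast; ring
  have e2 : n + 1 + k = n + k + 1 := by ring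
  have e3 : n + (k + 1) = n + k + 1 := by ring
  have e4 : ((n + 1 + 1).factorial : ℚ) = (n + 1 + 1) * (n + 1).factorial := by
    rw [Nat.factorial_succ]; push_cast; ring
  have e5 : ((k + 1).factorial : ℚ) = (k + 1) * k.factorial := by
    rw [Nat.factorial_succ]; push_cast; ring
  simp only [catalanTriangle, e1, e2, e3, e4, e5]
  push_cast
  field_simp
  ring

theorem catalanTriangle_self_succ (n : ℕ) : catalanTriangle n (n + 1) = 0 := by
  simp [catalanTriangle]

theorem catalanTriangle_succ_self (n : ℕ) :
    catalanTriangle (n + 1) (n + 1) = catalanTriangle (n + 1) n := by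
  rw [catalanTriangle_succ, catalanTriangle_self_succ, add_zero]

theorem sum_catalanTriangle (n k : ℕ) :
    ∑ j ∈ Finset.range (k + 1), catalanTriangle n j = catalanTriangle (n + 1) k := by
  induction k with
  | zero => simp [catalanTriangle_zero]
  | succ k ih => rw [Finset.sum_range_succ, ih, catalanTriangle_succ]

theorem catalanTriangle_self (n : ℕ) : catalanTriangle n n = catalan n := by
  have h : ((n + 1 : ℕ) : ℚ) * (catalan n : ℚ) = (n.centralBinom : ℚ) := by
    exact_mod_cast succ_mul_catalan_eq_centralBinom n
  have h1 : ((n.factorial : ℚ) * n.factorial) * (n.centralBinom : ℚ) = ((n + n).factorial : ℚ) := by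
    have := Nat.choose_mul_factorial_mul_factorial (show n ≤ 2 * n by omega)
    rw [show 2 * n - n = n by omega, ← Nat.centralBinom_eq_two_mul_choose, two_mul] at this
    rw [← this]
    push_cast
    ring
  have h2 : (n.factorial : ℚ) ≠ 0 := by exact_mod_cast n.factorial_ne_zero
  have h3 : (n : ℚ) + 1 ≠ 0 := by positivity
  push_cast at h
  rw [catalanTriangle, ← h1, ← h, Nat.factorial_succ]
  push_cast
  field_simp
  ring

/-- Let `S_n` be the sum on the left. Splitting off the last term, and separately applying the
recursion of the triangle, gives two equations which combine to `S_{n+1} = 4 S_n - C_{n+1}`; the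
recursion `(n + 2) C_{n+1} = 2 (2n + 1) C_n` closes the induction. -/
theorem sum_catalanTriangle_two_pow (n : ℕ) :
    ∑ k ∈ Finset.range (n + 1), catalanTriangle n k * 2 ^ (n - k) = (2 * n + 1) * catalan n := by
  induction n with
  | zero => simp [catalanTriangle_zero]
  | succ n ih =>
    have hc : ((n : ℚ) + 2) * catalan (n + 1) = 2 * (2 * n + 1) * catalan n := by
      have h1 : ((n + 1 + 1 : ℕ) : ℚ) * (catalan (n + 1) : ℚ) = ((n + 1).centralBinom : ℚ) := by
        exact_mod_cast succ_mul_catalan_eq_centralBinom (n + 1)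
      have h2 : ((n + 1 : ℕ) : ℚ) * (catalan n : ℚ) = (n.centralBinom : ℚ) := by
        exact_mod_cast succ_mul_catalan_eq_centralBinom n
      have h3 : ((n + 1 : ℕ) : ℚ) * ((n + 1).centralBinom : ℚ) =
          2 * (2 * n + 1) * (n.centralBinom : ℚ) := by
        exact_mod_cast Nat.succ_mul_centralBinom_succ n
      have h4 : (n : ℚ) + 1 ≠ 0 := by positivity
      rw [← h1, ← h2] at h3
      push_cast at h3
      have : ((n : ℚ) + 1) * (((n : ℚ) + 2) * catalan (n + 1)) =
          (n + 1) * (2 * (2 * n + 1) * catalan n) := by linear_combination h3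
      exact mul_left_cancel₀ h4 this
    have e1 : ∑ k ∈ Finset.range (n + 1 + 1), catalanTriangle (n + 1) k * 2 ^ (n + 1 - k) =
        2 * ∑ k ∈ Finset.range (n + 1), catalanTriangle (n + 1) k * 2 ^ (n - k) +
          catalan (n + 1) := by
      rw [Finset.sum_range_succ, catalanTriangle_self, Finset.mul_sum]
      simp only [Nat.sub_self, pow_zero, mul_one, add_left_inj]
      refine Finset.sum_congr rfl fun k hk => ?_
      rw [Finset.mem_range] at hk
      rw [show n + 1 - k = n - k + 1 by omega]
      ring
    have e2 : ∑ k ∈ Finset.range (n + 1 + 1), catalanTriangle (n + 1) k * 2 ^ (n + 1 - k) =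
        ∑ k ∈ Finset.range (n + 1), catalanTriangle (n + 1) k * 2 ^ (n - k) +
          ∑ k ∈ Finset.range (n + 1 + 1), catalanTriangle n k * 2 ^ (n + 1 - k) := by
      rw [Finset.sum_range_succ' _ (n + 1), Finset.sum_range_succ' _ (n + 1), ← add_assoc,
        ← Finset.sum_add_distrib, catalanTriangle_zero, catalanTriangle_zero]
      congr 1
      refine Finset.sum_congr rfl fun k hk => ?_
      rw [catalanTriangle_succ, show n + 1 - (k + 1) = n - k by omega]
      ring
    have e3 : ∑ k ∈ Finset.range (n + 1 + 1), catalanTriangle n k * 2 ^ (n + 1 - k) =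
        2 * ((2 * n + 1) * catalan n) := by
      rw [Finset.sum_range_succ, catalanTriangle_self_succ, zero_mul, add_zero, ← ih,
        Finset.mul_sum]
      refine Finset.sum_congr rfl fun k hk => ?_
      rw [Finset.mem_range] at hk
      rw [show n + 1 - k = n - k + 1 by omega]
      ring
    push_cast
    linear_combination 2 * e2 - e1 + 2 * e3 - 2 * hc

/-- With `n = m + 2`, the terms `k = n - 1` and `k = n` of the full sum contribute `2 C_n` and
`C_n`; what remains is four times the truncated sum. -/
theorem sum_catalanTriangle_two_pow_sub (m : ℕ) :
    ∑ k ∈ Finset.range (m + 1), catalanTriangle (m + 2) k * 2 ^ (m - k) + catalan (m + 2) =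
      ((m + 2 : ℕ) + 1) / 2 * (catalan (m + 2) : ℚ) := by
  have h := sum_catalanTriangle_two_pow (m + 2)
  rw [Finset.sum_range_succ, Finset.sum_range_succ, ← catalanTriangle_succ_self (m + 1),
    catalanTriangle_self] at h
  have e : ∑ k ∈ Finset.range (m + 1), catalanTriangle (m + 2) k * 2 ^ (m + 2 - k) =
      4 * ∑ k ∈ Finset.range (m + 1), catalanTriangle (m + 2) k * 2 ^ (m - k) := by
    rw [Finset.mul_sum]
    refine Finset.sum_congr rfl fun k hk => ?_
    rw [Finset.mem_range] at hk
    rw [show m + 2 - k = m - k + 2 by omega]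
    ring
  rw [e] at h
  simp only [Nat.sub_self, show m + 2 - (m + 1) = 1 by omega, pow_zero, pow_one] at h
  push_cast at h ⊢
  linear_combination h / 4

end Catalan

/-! ### Counting canonical words -/

section Counting

variable {d n : ℕ}

/-- Prepending a fixed element, as an embedding. -/
def consEmb {α : Type*} (a : α) : List α ↪ List α := ⟨List.cons a, List.cons_injective⟩

/-- The allowed prefix data of length `m`. -/
def allowedLists : ℕ → ℕ → Finset (List ℕ)
  | 0, _ => {[]}
  | m + 1, κ => (allowedLists m κ).map (consEmb (m + 2)) ∪
      (Finset.Icc 1 (min κ (m + 1))).biUnion fun i => (allowedLists m (i - 1)).map (consEmb i)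

theorem mem_allowedLists {m κ : ℕ} {l : List ℕ} :
    l ∈ allowedLists m κ ↔ l.length = m ∧ AllowedPrefix κ l := by
  induction m generalizing κ l with
  | zero =>
    simp only [allowedLists, Finset.mem_singleton, List.length_eq_zero_iff]
    exact ⟨fun h => ⟨h, h ▸ trivial⟩, fun h => h.1⟩
  | succ m ih =>
    simp only [allowedLists, Finset.mem_union, Finset.mem_map, Finset.mem_biUnion, Finset.mem_Icc,
      ih, consEmb, Function.Embedding.coeFn_mk]
    constructor
    · rintro (⟨l, ⟨rfl, h2⟩, rfl⟩ | ⟨i, hi, l, ⟨rfl, h2⟩, rfl⟩)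
      · exact ⟨rfl, .inl ⟨rfl, h2⟩⟩
      · exact ⟨rfl, .inr ⟨⟨hi.1, by omega, by omega⟩, h2⟩⟩
    · rintro ⟨h1, h2⟩
      obtain ⟨i, l, rfl⟩ := List.exists_cons_of_length_pos (l := l) (by omega)
      simp only [List.length_cons, Nat.add_right_cancel_iff] at h1
      subst h1
      rcases h2 with ⟨rfl, h2⟩ | ⟨h3, h2⟩
      · exact .inl ⟨l, ⟨rfl, h2⟩, rfl⟩
      · exact .inr ⟨i, ⟨h3.1, by omega⟩, l, ⟨rfl, h2⟩, rfl⟩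

theorem card_biUnion_consEmb {α : Type*} [DecidableEq α] (s : Finset α)
    (f : α → Finset (List α)) :
    (s.biUnion fun i => (f i).map (consEmb i)).card = ∑ i ∈ s, (f i).card := by
  rw [Finset.card_biUnion]
  · simp
  · intro i _ j _ hij
    rw [Function.onFun, Finset.disjoint_left]
    simp only [Finset.mem_map, consEmb, Function.Embedding.coeFn_mk]
    rintro _ ⟨l, _, rfl⟩ ⟨l', _, h⟩
    exact hij (List.cons_eq_cons.1 h).1.symm

/-- If the last block is empty, the bound is unchanged; if it starts at `i`, the bound becomes `i -
1`. Summing over `i` by `sum_catalanTriangle` leaves the recursion of the Catalan triangle. The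
minimum appears because a prefix of length `m` only involves `i ≤ m`. -/
theorem card_allowedLists (m κ : ℕ) :
    ((allowedLists m κ).card : ℚ) = catalanTriangle (m + 1) (min κ m) := by
  induction m generalizing κ with
  | zero => simp [allowedLists, catalanTriangle_zero]
  | succ m ih =>
    have hd : Disjoint ((allowedLists m κ).map (consEmb (m + 2)))
        ((Finset.Icc 1 (min κ (m + 1))).biUnion
          fun i => (allowedLists m (i - 1)).map (consEmb i)) := by
      rw [Finset.disjoint_left]
      simp only [Finset.mem_map, Finset.mem_biUnion, consEmb, Function.Embedding.coeFn_mk,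
        Finset.mem_Icc]
      rintro _ ⟨l, _, rfl⟩ ⟨i, hi, l', _, h⟩
      have := (List.cons_eq_cons.1 h).1
      omega
    rw [allowedLists, Finset.card_union_of_disjoint hd, Finset.card_map, card_biUnion_consEmb]
    push_cast
    rw [ih]
    have hs : ∑ i ∈ Finset.Icc 1 (min κ (m + 1)), ((allowedLists m (i - 1)).card : ℚ) =
        ∑ i ∈ Finset.range (min κ (m + 1)), catalanTriangle (m + 1) i := by
      rw [Finset.range_eq_Ico, Finset.sum_Ico_eq_sum_range, ← Finset.Ico_add_one_right_eq_Icc,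
        Finset.sum_Ico_eq_sum_range]
      refine Finset.sum_congr (by simp) fun i hi => ?_
      rw [Finset.mem_range] at hi
      rw [ih, show min (1 + i - 1) m = i by omega, zero_add]
    rw [hs]
    rcases Nat.eq_zero_or_pos κ with rfl | hκ
    · simp [catalanTriangle_zero]
    · obtain ⟨k, hk⟩ : ∃ k, min κ (m + 1) = k + 1 := ⟨min κ (m + 1) - 1, by omega⟩
      rw [hk, sum_catalanTriangle, catalanTriangle_succ, add_comm]
      congr 1
      rcases le_or_gt κ m with h | h
      · congr 1; omega
      · rw [show min κ m = m by omega, show k = m by omega, catalanTriangle_succ_self]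

/-- The color lists of length `m` with sum `a`. -/
def colorLists (d : ℕ) [NeZero d] : ℕ → ZMod d → Finset (List (ZMod d))
  | 0, a => if a = 0 then {[]} else ∅
  | m + 1, a => Finset.univ.biUnion fun c => (colorLists d m (a - c)).map (consEmb c)

theorem mem_colorLists [NeZero d] {m : ℕ} {a : ZMod d} {cs : List (ZMod d)} :
    cs ∈ colorLists d m a ↔ cs.length = m ∧ cs.sum = a := by
  induction m generalizing a cs with
  | zero =>
    rw [colorLists, List.length_eq_zero_iff]
    split_ifs with h
    · simp only [Finset.mem_singleton]
      exact ⟨fun h' => ⟨h', by simp [h', h]⟩, fun h' => h'.1⟩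
    · simp only [Finset.notMem_empty, false_iff, not_and]
      rintro rfl h'
      exact h (by simpa using h'.symm)
  | succ m ih =>
    simp only [colorLists, Finset.mem_biUnion, Finset.mem_univ, true_and, Finset.mem_map, ih,
      consEmb, Function.Embedding.coeFn_mk]
    constructor
    · rintro ⟨c, cs, ⟨h1, h2⟩, rfl⟩
      exact ⟨by simp [h1], by simp [h2]⟩
    · rintro ⟨h1, h2⟩
      obtain ⟨c, cs, rfl⟩ := List.exists_cons_of_length_pos (l := cs) (by omega)
      exact ⟨c, cs, ⟨by simpa using h1, by rw [← h2]; simp⟩, rfl⟩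

theorem card_colorLists [NeZero d] (m : ℕ) (a : ZMod d) :
    (colorLists d (m + 1) a).card = d ^ m := by
  induction m generalizing a with
  | zero =>
    rw [colorLists, card_biUnion_consEmb, Finset.sum_eq_single a]
    · simp [colorLists]
    · intro b _ hb
      simp [colorLists, sub_eq_zero, hb.symm]
    · simp
  | succ m ih =>
    rw [colorLists, card_biUnion_consEmb, Finset.sum_congr rfl fun c _ => ih _]
    simp [ZMod.card, pow_succ']

/-- The number of color lists with `r` entries left from the first nonzero one on and sum zero. -/
def colorCount (d : ℕ) : ℕ → ℕ
  | 0 => 1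
  | 1 => 0
  | r + 2 => (d - 1) * d ^ r

/-- The first nonzero color can be chosen in `d - 1` ways, the following ones freely, and the last
is forced by the sum. If the first nonzero position is the last one, this is impossible. -/
theorem card_colorLists_filter [NeZero d] {m j k : ℕ} (hj : 1 ≤ j) (h1 : j ≤ k + 1)
    (h2 : k + 1 ≤ j + m) :
    ((colorLists d m 0).filter fun cs => firstColor j cs = k).card =
      colorCount d (j + m - (k + 1)) := by
  induction m generalizing j with
  | zero =>
    obtain rfl : j = k + 1 := by omega
    simp [colorLists, Finset.filter_singleton, firstColor, colorCount]
  | succ m ih =>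
    rcases h1.eq_or_lt with rfl | h1
    · have e : (colorLists d (m + 1) 0).filter (fun cs => firstColor (k + 1) cs = k) =
          (Finset.univ.erase 0).biUnion fun c => (colorLists d m (0 - c)).map (consEmb c) := by
        ext cs
        simp only [Finset.mem_filter, mem_colorLists, Finset.mem_biUnion, Finset.mem_erase,
          Finset.mem_univ, and_true, Finset.mem_map, consEmb, Function.Embedding.coeFn_mk]
        constructor
        · rintro ⟨⟨h3, h4⟩, h5⟩
          obtain ⟨c, cs, rfl⟩ := List.exists_cons_of_length_pos (l := cs) (by omega)
          refine ⟨c, fun hc => ?_, cs, ⟨by simpa using h3, ?_⟩, rfl⟩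
          · rw [firstColor, if_pos hc] at h5
            have := le_firstColor (k + 1 + 1) cs
            omega
          · rw [← h4]; simp
        · rintro ⟨c, hc, cs, ⟨h3, h4⟩, rfl⟩
          refine ⟨⟨by simp [h3], by simp [h4]⟩, ?_⟩
          rw [firstColor, if_neg hc]
          rfl
      rw [e, card_biUnion_consEmb, show k + 1 + (m + 1) - (k + 1) = m + 1 by omega]
      rcases m with _ | m
      · refine Finset.sum_eq_zero fun c hc => ?_
        simp [colorLists, (Finset.mem_erase.1 hc).1]
      · rw [Finset.sum_congr rfl fun c _ => card_colorLists m (0 - c)]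
        simp [colorCount, ZMod.card]
    · have e : (colorLists d (m + 1) 0).filter (fun cs => firstColor j cs = k) =
          ((colorLists d m 0).filter fun cs => firstColor (j + 1) cs = k).map (consEmb 0) := by
        ext cs
        simp only [Finset.mem_filter, mem_colorLists, Finset.mem_map, consEmb,
          Function.Embedding.coeFn_mk]
        constructor
        · rintro ⟨⟨h3, h4⟩, h5⟩
          obtain ⟨c, cs, rfl⟩ := List.exists_cons_of_length_pos (l := cs) (by omega)
          rw [firstColor] at h5
          split_ifs at h5 with hc
          · subst hc
            exact ⟨cs, ⟨⟨by simpa using h3, by simpa using h4⟩, h5⟩, rfl⟩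
          · omega
        · rintro ⟨cs, ⟨⟨h3, h4⟩, h5⟩, rfl⟩
          exact ⟨⟨by simp [h3], by simp [h4]⟩, by rw [firstColor, if_pos rfl, h5]⟩
      rw [e, Finset.card_map, ih (by omega) (by omega) (by omega)]
      congr 1
      omega

theorem firstColor_le {j : ℕ} (cs : List (ZMod d)) : firstColor j cs ≤ j - 1 + cs.length := by
  induction cs generalizing j with
  | nil => simp [firstColor]
  | cons c cs ih =>
    rw [firstColor]
    split_ifs
    · have := @ih (j + 1)
      simp only [List.length_cons]
      omega
    · omega

/-- The data of the canonical words of the fully commutative elements of `G(d,d,n)`. -/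
def fcData (d n : ℕ) [NeZero d] : Finset (Σ _ : List (ZMod d), List ℕ) :=
  (colorLists d n 0).sigma fun cs => allowedLists (n - 1) (firstColor 1 cs)

theorem card_fcData [NeZero d] (hn : 1 ≤ n) :
    ((fcData d n).card : ℚ) =
      ∑ k ∈ Finset.range (n + 1), catalanTriangle n k * (colorCount d (n - k) : ℚ) := by
  have hmaps : ∀ cs ∈ colorLists d n 0, firstColor 1 cs ∈ Finset.range (n + 1) := by
    intro cs hcs
    rw [mem_colorLists] at hcs
    have := firstColor_le (j := 1) cs
    rw [Finset.mem_range]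
    omega
  rw [fcData, Finset.card_sigma, Nat.cast_sum, ← Finset.sum_fiberwise_of_maps_to hmaps]
  refine Finset.sum_congr rfl fun k hk => ?_
  rw [Finset.mem_range] at hk
  have e : ∀ cs ∈ (colorLists d n 0).filter (fun cs => firstColor 1 cs = k),
      ((allowedLists (n - 1) (firstColor 1 cs)).card : ℚ) = catalanTriangle n k := by
    intro cs hcs
    rw [(Finset.mem_filter.1 hcs).2, card_allowedLists]
    obtain ⟨m, rfl⟩ : ∃ m, n = m + 1 := ⟨n - 1, by omega⟩
    simp only [Nat.add_sub_cancel]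
    -- The empty suffix gives `k = n`, where the bound is cut off at `n - 1`; the count still agrees
    -- since `C(n,n) = C(n,n-1)`.
    rcases (show k ≤ m ∨ k = m + 1 by omega) with h | rfl
    · rw [min_eq_left h]
    · rw [min_eq_right (by omega), catalanTriangle_succ_self]
  rw [Finset.sum_congr rfl e, Finset.sum_const, nsmul_eq_mul, mul_comm,
    card_colorLists_filter le_rfl (by omega) (by omega)]
  congr 3
  omega

theorem sum_colorCount (hd : 1 ≤ d) (m : ℕ) :
    ∑ k ∈ Finset.range (m + 2 + 1), catalanTriangle (m + 2) k * (colorCount d (m + 2 - k) : ℚ) =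
      ((d : ℚ) - 1) * (∑ k ∈ Finset.range (m + 1), catalanTriangle (m + 2) k * (d : ℚ) ^ (m - k)) +
        catalan (m + 2) := by
  rw [Finset.sum_range_succ, Finset.sum_range_succ, catalanTriangle_self, Finset.mul_sum]
  have h0 : colorCount d 0 = 1 := rfl
  have h1 : colorCount d 1 = 0 := rfl
  simp only [Nat.sub_self, show m + 2 - (m + 1) = 1 by omega, h0, h1, Nat.cast_zero, mul_zero,
    add_zero, Nat.cast_one, mul_one, add_left_inj]
  refine Finset.sum_congr rfl fun k hk => ?_
  rw [Finset.mem_range] at hk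
  rw [show m + 2 - k = m - k + 2 by omega, colorCount]
  push_cast [hd]
  ring

end Counting

/-! ### Packets -/

section Packets

variable {d n : ℕ}

/-- The suffix data of a list of colors `c_j, c_{j+1}, …`. -/
def suffixData : ℕ → List (ZMod d) → List (ℕ × ℕ)
  | _, [] => []
  | j, c :: cs => if c = 0 then suffixData (j + 1) cs else (j, c.val) :: suffixData (j + 1) cs

theorem suffixWord_suffixData (j : ℕ) (cs : List (ZMod d)) :
    suffixWord n (suffixData j cs) = colorWord n j cs := by
  induction cs generalizing j with
  | nil => rfl
  | cons c cs ih =>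
    rw [suffixData, colorWord, ← ih, colorBlock]
    split_ifs <;> simp [suffixWord]

theorem mem_suffixData [NeZero d] {j : ℕ} {cs : List (ZMod d)} {y : ℕ × ℕ}
    (h : y ∈ suffixData j cs) :
    (j ≤ y.1 ∧ y.1 < j + cs.length) ∧ 1 ≤ y.2 ∧ y.2 ≤ d - 1 := by
  induction cs generalizing j with
  | nil => simp [suffixData] at h
  | cons c cs ih =>
    have hr : y ∈ suffixData (j + 1) cs → (j ≤ y.1 ∧ y.1 < j + (c :: cs).length) ∧
        1 ≤ y.2 ∧ y.2 ≤ d - 1 := by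
      intro h
      have := ih h
      simp only [List.length_cons]
      omega
    rw [suffixData] at h
    split_ifs at h with hc
    · exact hr h
    · rcases List.mem_cons.1 h with rfl | h
      · have h1 := ZMod.val_lt c
        have h2 : c.val ≠ 0 := fun h => hc ((ZMod.val_eq_zero c).1 h)
        simp only [List.length_cons]
        omega
      · exact hr h

theorem suffixData_pairwise [NeZero d] (j : ℕ) (cs : List (ZMod d)) :
    ((suffixData j cs).map Prod.fst).Pairwise (· < ·) := by
  induction cs generalizing j with
  | nil => simp [suffixData]
  | cons c cs ih =>
    rw [suffixData]
    split_ifs with hc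
    · exact ih (j + 1)
    · rw [List.map_cons, List.pairwise_cons]
      refine ⟨fun i hi => ?_, ih (j + 1)⟩
      obtain ⟨y, hy, rfl⟩ := List.mem_map.1 hi
      have := (mem_suffixData hy).1.1
      simp only
      omega

theorem isSuffixData_suffixData [NeZero d] {cs : List (ZMod d)} (h : cs.length = n) :
    IsSuffixData d n (suffixData 1 cs) := by
  refine ⟨suffixData_pairwise 1 cs, fun y hy => ?_⟩
  have := mem_suffixData hy
  omega

theorem exists_suffixData [NeZero d] {L : List (ℕ × ℕ)} {j m : ℕ}
    (h1 : (L.map Prod.fst).Pairwise (· < ·))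
    (h2 : ∀ y ∈ L, (j ≤ y.1 ∧ y.1 < j + m) ∧ 1 ≤ y.2 ∧ y.2 ≤ d - 1) :
    ∃ cs : List (ZMod d), cs.length = m ∧ suffixData j cs = L := by
  induction m generalizing j L with
  | zero =>
    refine ⟨[], rfl, ?_⟩
    rw [suffixData, eq_comm, List.eq_nil_iff_forall_not_mem]
    intro y hy
    have := h2 y hy
    omega
  | succ m ih =>
    by_cases hj : ∃ k L', L = (j, k) :: L'
    · obtain ⟨k, L', rfl⟩ := hj
      rw [List.map_cons, List.pairwise_cons] at h1
      obtain ⟨cs, h3, h4⟩ := ih (j := j + 1) (L := L') h1.2 (by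
        intro y hy
        have e1 := h2 y (List.mem_cons_of_mem _ hy)
        have e2 := h1.1 y.1 (List.mem_map_of_mem hy)
        simp only at e2
        omega)
      have hk := (h2 _ List.mem_cons_self).2
      simp only at hk
      have hv : (k : ZMod d).val = k := ZMod.val_cast_of_lt (by omega)
      refine ⟨k :: cs, by simp [h3], ?_⟩
      rw [suffixData, if_neg, hv, h4]
      intro h0
      rw [h0, ZMod.val_zero] at hv
      omega
    · obtain ⟨cs, h3, h4⟩ := ih (j := j + 1) (L := L) h1 (by
        intro y hy
        have e1 := h2 y hy
        suffices y.1 ≠ j by omega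
        rintro rfl
        rcases L with _ | ⟨z, L⟩
        · simp at hy
        · rcases List.mem_cons.1 hy with rfl | hy'
          · exact hj ⟨_, _, rfl⟩
          · rw [List.map_cons, List.pairwise_cons] at h1
            have e2 := h1.1 y.1 (List.mem_map_of_mem hy')
            have e3 := h2 z List.mem_cons_self
            omega)
      exact ⟨0 :: cs, by simp [h3], by rw [suffixData, if_pos rfl, h4]⟩

theorem sum_suffixData [NeZero d] (j : ℕ) (cs : List (ZMod d)) :
    ((suffixData j cs).map fun y => (y.2 : ZMod d)).sum = cs.sum := by
  induction cs generalizing j with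
  | nil => rfl
  | cons c cs ih =>
    rw [suffixData]
    split_ifs with hc
    · rw [ih, List.sum_cons, hc, zero_add]
    · rw [List.map_cons, List.sum_cons, ih, List.sum_cons, ZMod.natCast_zmod_val]

theorem firstColor_eq (j : ℕ) (cs : List (ZMod d)) :
    (suffixData j cs = [] → firstColor j cs = j + cs.length - 1) ∧
    (∀ y L, suffixData j cs = y :: L → firstColor j cs = y.1 - 1) := by
  induction cs generalizing j with
  | nil => simp [suffixData, firstColor]
  | cons c cs ih =>
    rw [suffixData, firstColor]
    split_ifs with hc
    · refine ⟨fun h => ?_, (ih (j + 1)).2⟩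
      rw [(ih (j + 1)).1 h, List.length_cons]
      omega
    · refine ⟨by simp, fun y L h => ?_⟩
      rw [← (List.cons_eq_cons.1 h).1]

theorem natCast_ne_zero_of_lt {t : ℕ} (h : 1 ≤ t ∧ t ≤ d - 1) : (t : ZMod d) ≠ 0 := by
  rw [Ne, ZMod.natCast_eq_zero_iff]
  intro h'
  have := Nat.le_of_dvd (by omega) h'
  omega

/-- A label with a single block has a nonzero color sum. The remaining labels are the empty suffix,
with `k = n`, and those with at least two blocks, with `k = j_1 - 1`; in both cases `k` is the bound
given by the first nonzero color. -/
theorem firstColor_eq_of_isPacketLabel [NeZero d] {k : ℕ} {cs : List (ZMod d)}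
    (hlen : cs.length = n) (hs : cs.sum = 0) (h : IsPacketLabel n k (suffixData 1 cs)) :
    firstColor 1 cs = k := by
  have single : ∀ y, suffixData 1 cs ≠ [y] := by
    intro y hy
    have h1 := (mem_suffixData (cs := cs) (j := 1) (y := y) (by rw [hy]; simp)).2
    have h2 := sum_suffixData 1 cs
    rw [hy, hs] at h2
    exact natCast_ne_zero_of_lt h1 (by simpa using h2)
  rcases h with ⟨rfl, h⟩ | ⟨_, t, h | h⟩ | ⟨_, t, y, L, h⟩ | ⟨_, _, t, h⟩
  · rw [(firstColor_eq 1 cs).1 h]; omega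
  · exact absurd h (single _)
  · exact absurd h (single _)
  · rw [(firstColor_eq 1 cs).2 _ _ h]; rfl
  · exact absurd h (single _)

theorem isPacketLabel_of_firstColor_eq [NeZero d] {k : ℕ} {cs : List (ZMod d)}
    (hlen : cs.length = n) (hs : cs.sum = 0) (h : firstColor 1 cs = k) :
    IsPacketLabel n k (suffixData 1 cs) := by
  rcases hL : suffixData 1 cs with _ | ⟨y, _ | ⟨z, L⟩⟩
  · rw [(firstColor_eq 1 cs).1 hL] at h
    exact .inl ⟨by omega, rfl⟩
  · have h1 := (mem_suffixData (cs := cs) (j := 1) (y := y) (by rw [hL]; simp)).2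
    have h2 := sum_suffixData 1 cs
    rw [hL, hs] at h2
    exact absurd (by simpa using h2) (natCast_ne_zero_of_lt h1)
  · rw [(firstColor_eq 1 cs).2 _ _ hL] at h
    have h1 := (mem_suffixData (cs := cs) (j := 1) (y := y) (by rw [hL]; simp)).1
    have h2 := (mem_suffixData (cs := cs) (j := 1) (y := z) (by rw [hL]; simp)).1
    have h3 := suffixData_pairwise 1 cs
    rw [hL, List.map_cons, List.map_cons, List.pairwise_cons] at h3
    have h4 := h3.1 z.1 (by simp)
    refine .inr (.inr (.inl ⟨by omega, y.2, z, L, ?_⟩))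
    congr 1
    ext
    · simp only; omega
    · rfl

theorem isPrefix_nil : IsPrefix n [] := by
  refine ⟨fun p => p + 1, fun p _ _ => ⟨Nat.le_add_left 1 p, le_rfl⟩, ?_⟩
  rw [eq_comm, List.flatten_eq_nil_iff]
  intro w hw
  obtain ⟨p, -, rfl⟩ := List.mem_map.1 hw
  exact desc_nil (Nat.lt_succ_self _)

theorem IsPrefix.exists_prefixWord {w : List (Fin n)} (h : IsPrefix n w) :
    ∃ l, ValidPrefix l ∧ l.length = n - 1 ∧ w = prefixWord n l := by
  obtain ⟨i, hi, rfl⟩ := h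
  have key : ∀ m, m ≤ n - 1 → ∃ l, ValidPrefix l ∧ l.length = m ∧
      ((List.range m).map fun p => desc n (p + 1) (i (p + 1))).flatten = prefixWord n l := by
    intro m
    induction m with
    | zero => exact fun _ => ⟨[], trivial, rfl, rfl⟩
    | succ m ih =>
      intro hm
      obtain ⟨l, h1, h2, h3⟩ := ih (by omega)
      refine ⟨i (m + 1) :: l, ⟨?_, h1⟩, by simp [h2], ?_⟩
      · have := hi (m + 1) (by omega) hm
        omega
      · rw [List.range_succ, List.map_append, List.flatten_append, h3, prefixWord, h2]
        simp
  exact key (n - 1) le_rfl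

/-- Empty prefix blocks are always allowed, so a suffix lies in its own collection. Collections are
therefore nonempty: containment in the image of `ι` is never vacuous, and different color lists
label different collections. -/
theorem colorWord_mem_collection (hd : 2 ≤ d) (hn : 1 ≤ n) {cs : List (ZMod d)}
    (h : cs.length = n) : colorWord n 1 cs ∈ collection d n (colorWord n 1 cs) := by
  refine ⟨[], isPrefix_nil, rfl, ?_⟩
  have hid : ∀ m κ, ∃ l, AllowedPrefix κ l ∧ l.length = m ∧ prefixWord n l = [] := by
    intro m κ
    induction m with
    | zero => exact ⟨[], trivial, rfl, rfl⟩
    | succ m ih =>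
      obtain ⟨l, h1, h2, h3⟩ := ih
      exact ⟨(m + 2) :: l, .inl ⟨by rw [h2], h1⟩, by simp [h2],
        by rw [prefixWord, h3, h2, desc_nil (by omega), List.append_nil]⟩
  obtain ⟨l, h1, h2, h3⟩ := hid (n - 1) (firstColor 1 cs)
  have := fullyCommutative_canonicalWord hd hn h2 h h1
  rwa [canonicalWord, h3] at this

theorem colorWord_eq_canonicalWord (cs : List (ZMod d)) :
    ∃ l, ValidPrefix l ∧ l.length = n - 1 ∧ colorWord n 1 cs = canonicalWord n l cs := by
  obtain ⟨l, h1, h2, h3⟩ := (isPrefix_nil (n := n)).exists_prefixWord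
  exact ⟨l, h1, h2, by rw [canonicalWord, ← h3, List.nil_append]⟩

theorem eval_canonicalWord_mem_range_iff (hd : 2 ≤ d) (hn : 3 ≤ n) {l : List ℕ}
    (hl : l.length = n - 1) (cs : List (ZMod d)) :
    eval d n (canonicalWord n l cs) ∈ (iota d n hd hn).range ↔ cs.sum = 0 := by
  have : NeZero d := ⟨by omega⟩
  have ht : (⟨n - 1, by omega⟩ : Fin n).val + 1 = n := by simp; omega
  rw [eval_mem_range_iff hd hn ht, count_canonicalWord ht (by omega)]

theorem packetD_eq_image [NeZero d] (hd : 2 ≤ d) (hn : 3 ≤ n) (k : ℕ) :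
    packetD d n k hd hn = (fun cs => collection d n (colorWord n 1 cs)) ''
      (↑((colorLists d n 0).filter fun cs => firstColor 1 cs = k) : Set (List (ZMod d))) := by
  ext c
  simp only [Set.mem_image, Finset.mem_coe, Finset.mem_filter, mem_colorLists]
  constructor
  · rintro ⟨⟨L, ⟨h1, h2⟩, h3, rfl⟩, h4⟩
    obtain ⟨cs, h5, rfl⟩ := exists_suffixData (d := d) (j := 1) (m := n) h1 (by
      intro y hy
      have := h2 y hy
      omega)
    rw [suffixWord_suffixData] at h4 ⊢
    -- Testing the containment on the bare suffix forces its color sum to vanish.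
    have h6 := h4 _ (colorWord_mem_collection hd (by omega) h5)
    obtain ⟨l, h7, h8, h9⟩ := colorWord_eq_canonicalWord (n := n) cs
    rw [h9, eval_canonicalWord_mem_range_iff hd hn h8] at h6
    exact ⟨cs, ⟨⟨h5, h6⟩, firstColor_eq_of_isPacketLabel h5 h6 h3⟩, rfl⟩
  · rintro ⟨cs, ⟨⟨h1, h2⟩, h3⟩, rfl⟩
    refine ⟨⟨suffixData 1 cs, isSuffixData_suffixData h1,
      isPacketLabel_of_firstColor_eq h1 h2 h3, by rw [suffixWord_suffixData]⟩, ?_⟩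
    rintro w ⟨w₀, h4, rfl, -⟩
    obtain ⟨l, -, h5, rfl⟩ := h4.exists_prefixWord
    exact (eval_canonicalWord_mem_range_iff hd hn h5 cs).2 h2

theorem ncard_packetD (hd : 2 ≤ d) (hn : 3 ≤ n) {k : ℕ} (hk : k ≤ n) :
    (packetD d n k hd hn).ncard = colorCount d (n - k) := by
  have : NeZero d := ⟨by omega⟩
  rw [packetD_eq_image, Set.InjOn.ncard_image, Set.ncard_coe_finset,
    card_colorLists_filter le_rfl (by omega) (by omega)]
  · congr 1; omega
  · intro cs hcs cs' hcs' h
    simp only [Finset.mem_coe, Finset.mem_filter, mem_colorLists] at hcs hcs' h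
    have h1 := colorWord_mem_collection (d := d) (n := n) hd (by omega) hcs.1.1
    rw [h] at h1
    obtain ⟨w₀, h2, h3, -⟩ := h1
    obtain ⟨l', h4, h5, rfl⟩ := h2.exists_prefixWord
    obtain ⟨l, h6, h7, h8⟩ := colorWord_eq_canonicalWord (n := n) cs
    rw [h8] at h3
    exact (canonicalWord_injective (d := d) (n := n) (by omega) h6 h4 h7 h5 hcs.1.1 hcs'.1.1
      (by rw [h3]; rfl)).2

/-! ### The fully commutative elements of `G(d,d,n)` -/

/-- Membership in the image of `ι` is the vanishing of the color sum, and under that condition full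
commutativity is equivalent to the prefix being allowed. -/
theorem iota_image_fcElements [NeZero d] (hd : 2 ≤ d) (hn : 3 ≤ n) :
    iota d n hd hn '' fcElements d n hd hn =
      (fun y : Σ _ : List (ZMod d), List ℕ => eval d n (canonicalWord n y.2 y.1)) ''
        (fcData d n : Set _) := by
  ext g
  simp only [Set.mem_image, Finset.mem_coe, fcData, Finset.mem_sigma, mem_colorLists,
    mem_allowedLists]
  constructor
  · rintro ⟨g, hg, rfl⟩
    obtain ⟨w₀, h₀⟩ := id hg
    have hw : w₀ ∈ reducedWords d n (iota d n hd hn g) := by rw [h₀]; exact CommEquiv.refl _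
    obtain ⟨l, cs, h1, h2, h3, h4⟩ := exists_reduces_canonicalWord (d := d) hd (by omega) w₀
    have h5 := h4.1.symm.trans hw.1
    have h6 := (eval_canonicalWord_mem_range_iff hd hn h2 cs).1 ⟨g, h5.symm⟩
    have hg' : FullyCommutative d n (iota d n hd hn g) := hg
    rw [← h5] at hg'
    exact ⟨⟨cs, l⟩, ⟨⟨h3, h6⟩, h2,
      allowedPrefix_of_fullyCommutative hd (by omega) h1 h2 h3 h6 hg'⟩, h5⟩
  · rintro ⟨⟨cs, l⟩, ⟨⟨h1, h2⟩, h3, h4⟩, rfl⟩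
    obtain ⟨g, hg⟩ := (eval_canonicalWord_mem_range_iff hd hn h3 cs).2 h2
    refine ⟨g, ?_, hg⟩
    show FullyCommutative d n (iota d n hd hn g)
    rw [hg]
    exact fullyCommutative_canonicalWord hd (by omega) h3 h1 h4

theorem fcElements_finite (hd : 2 ≤ d) (hn : 3 ≤ n) : (fcElements d n hd hn).Finite := by
  have : NeZero d := ⟨by omega⟩
  refine Set.Finite.of_finite_image ?_ (iota_injective hd hn).injOn
  rw [iota_image_fcElements]
  exact (Finset.finite_toSet _).image _

theorem ncard_fcElements [NeZero d] (hd : 2 ≤ d) (hn : 3 ≤ n) :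
    (fcElements d n hd hn).ncard = (fcData d n).card := by
  rw [← Set.ncard_image_of_injective _ (iota_injective hd hn), iota_image_fcElements,
    Set.InjOn.ncard_image, Set.ncard_coe_finset]
  rintro ⟨cs, l⟩ h ⟨cs', l'⟩ h' he
  simp only [Finset.mem_coe, fcData, Finset.mem_sigma, mem_colorLists, mem_allowedLists] at h h'
  obtain ⟨rfl, rfl⟩ := canonicalWord_injective (d := d) (n := n) (by omega) h.2.2.valid
    h'.2.2.valid h.2.1 h'.2.1 h.1.1 h'.1.1 he
  rfl

end Packets

end ReflFC

theorem corollary5p3 (d n : ℕ) (hd : 2 ≤ d) (hn : 3 ≤ n) :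
    (ReflFC.fcElements d n hd hn).Finite ∧
    ((ReflFC.fcElements d n hd hn).ncard : ℚ) =
      ∑ k ∈ Finset.range (n + 1),
        ReflFC.catalanTriangle n k * ((ReflFC.packetD d n k hd hn).ncard : ℚ) ∧
    ((ReflFC.fcElements d n hd hn).ncard : ℚ) =
      ((d : ℚ) - 1) * (ReflFC.catalanPoly n (n - 2)).eval (d : ℚ) + (catalan n : ℚ) ∧
    (d = 2 → ((ReflFC.fcElements d n hd hn).ncard : ℚ) =
      ((n : ℚ) + 1) / 2 * (catalan n : ℚ)) := by
  have : NeZero d := ⟨by omega⟩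
  -- Writing `n = m + 2` removes the truncated subtraction in the index `n - 2` of the polynomial.
  obtain ⟨m, rfl⟩ : ∃ m, n = m + 2 := ⟨n - 2, by omega⟩
  have h1 := ReflFC.card_fcData (d := d) (n := m + 2) (by omega)
  have h2 := ReflFC.sum_colorCount (d := d) (by omega) m
  rw [ReflFC.ncard_fcElements]
  refine ⟨ReflFC.fcElements_finite hd hn, ?_, ?_, ?_⟩
  · rw [h1]
    refine Finset.sum_congr rfl fun k hk => ?_
    rw [ReflFC.ncard_packetD hd hn (by rw [Finset.mem_range] at hk; omega)]
  · rw [h1, h2, ReflFC.catalanPoly, Polynomial.eval_finsetSum]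
    simp
  · rintro rfl
    rw [h1, h2, ← ReflFC.sum_catalanTriangle_two_pow_sub]
    norm_num
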